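/- Let $f:\hat{\mathbb C}\to\hat{\mathbb C}$ be a rational map of degree at least $2$ of the Riemann sphere, and let $\hat z$ be an attracting fixed point of $f$, i.e. $f(\hat z)=\hat z$ and the multiplier $\lambda=f'(\hat z)$ (computed in a local coordinate) satisfies $|\lambda|<1$. Let $\Omega=\{z : f^{\circ n}(z)\to\hat z \text{ as } n\to\infty\}$ be the basin of attraction of $\hat z$, and let the immediate basin $\Omega_0$ be the connected component of $\Omega$ that contains $\hat z$. Then $\Omega_0$ contains at least one critical point of $f$. Furthermore, suppose $\lambda\neq 0$. Call a holomorphic map $\phi:\Omega\to\mathbb C$ a Kœnigs map if $\phi(f(z))=\lambda\,\phi(z)$ for all $z\in\Omega$ and $\phi$ is a local diffeomorphism at $\hat z$ (i.e. its derivative at $\hat z$ is nonzero). Then a Kœnigs map exists, and for every Kœnigs map $\phi$ there is a unique compact neighborhood $\bar U$ of $\hat z$ in $\Omega_0$ such that (a) for some $r>0$, $\phi$ maps $\bar U$ bijectively onto the closed round disk $\bar D_r=\{w\in\mathbb C : |w|\le r\}$, and (b) the boundary of $\bar U$ contains at least one critical point of $f$. -/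

import Mathlib

open Filter Topology OnePoint

namespace RationalDynamics

noncomputable section

/-- The standard chart of the Riemann sphere `OnePoint ℂ` around `p`, extended by a junk value to
the whole sphere: the identity `z ↦ z` if `p` is finite, and `z ↦ 1 / z` if `p = ∞`. -/
def chart : OnePoint ℂ → OnePoint ℂ → ℂ
  | ∞, ∞ => 0
  | ∞, (z : ℂ) => z⁻¹
  | (_ : ℂ), ∞ => 0
  | (_ : ℂ), (z : ℂ) => z

open scoped Classical in
/-- The inverse of the chart around `p`: `w ↦ w` if `p` is finite, and `w ↦ 1 / w` (with
`0 ↦ ∞`) if `p = ∞`. -/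
def chartInv : OnePoint ℂ → ℂ → OnePoint ℂ
  | ∞, w => if w = 0 then ∞ else ((w⁻¹ : ℂ) : OnePoint ℂ)
  | (_ : ℂ), w => (w : OnePoint ℂ)

/-- The derivative at `p` of a self-map of the sphere, read in the charts around `p` and `f p`. -/
def localDeriv (f : OnePoint ℂ → OnePoint ℂ) (p : OnePoint ℂ) : ℂ :=
  deriv (fun w : ℂ => chart (f p) (f (chartInv p w))) (chart p p)

/-- Critical points: the first derivative vanishes in local coordinates. -/
def IsCriticalPoint (f : OnePoint ℂ → OnePoint ℂ) (p : OnePoint ℂ) : Prop :=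
  localDeriv f p = 0

/-- The multiplier of `f` at a fixed point `p`
(the same chart is then used in the source and in the target). -/
def multiplier (f : OnePoint ℂ → OnePoint ℂ) (p : OnePoint ℂ) : ℂ :=
  localDeriv f p

/-- Attracting fixed points, superattracting ones included. -/
def IsAttractingFixedPoint (f : OnePoint ℂ → OnePoint ℂ) (p : OnePoint ℂ) : Prop :=
  f p = p ∧ ‖multiplier f p‖ < 1

/-- The basin of attraction of `p`. -/
def basin (f : OnePoint ℂ → OnePoint ℂ) (p : OnePoint ℂ) : Set (OnePoint ℂ) :=
  {z | Tendsto (fun n : ℕ => f^[n] z) atTop (𝓝 p)}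

/-- The immediate basin: the connected component of `p` in its basin of attraction. -/
def immediateBasin (f : OnePoint ℂ → OnePoint ℂ) (p : OnePoint ℂ) : Set (OnePoint ℂ) :=
  connectedComponentIn (basin f p) p

open scoped Classical in
/-- The self-map of the Riemann sphere given by a rational function `R = P / Q` in lowest terms. -/
def ratMap (R : RatFunc ℂ) : OnePoint ℂ → OnePoint ℂ
  | ∞ =>
    if R.denom.natDegree < R.num.natDegree then ∞
    else ((R.num.coeff R.denom.natDegree / R.denom.leadingCoeff : ℂ) : OnePoint ℂ)
  | (z : ℂ) =>
    if R.denom.eval z = 0 then ∞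
    else ((R.num.eval z / R.denom.eval z : ℂ) : OnePoint ℂ)

/-- The degree of a rational map `P / Q` in lowest terms: `max (deg P) (deg Q)`. -/
def ratDegree (R : RatFunc ℂ) : ℕ :=
  max R.num.natDegree R.denom.natDegree

/-- `φ` (of which only the values on the basin of `p` matter) is a Koenigs map for `f` at `p`:
it is holomorphic on the basin, it conjugates `f` to multiplication by the multiplier there, and
it is a local diffeomorphism at `p`. The functional equation forces `φ p = 0` for multipliers
other than `1`. -/
structure IsKoenigsMap (f : OnePoint ℂ → OnePoint ℂ) (p : OnePoint ℂ) (φ : OnePoint ℂ → ℂ) :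
    Prop where
  holomorphic : ∀ z ∈ basin f p, AnalyticAt ℂ (fun w : ℂ => φ (chartInv z w)) (chart z z)
  map_eq : ∀ z ∈ basin f p, φ (f z) = multiplier f p * φ z
  deriv_ne_zero : deriv (fun w : ℂ => φ (chartInv p w)) (chart p p) ≠ 0

end

end RationalDynamics

open RationalDynamics

/-!
Let `f` be the rational map, `p` the attracting fixed point, `λ` its multiplier. If `λ = 0`,
then `p` itself is critical. Otherwise everything follows from the study of a Koenigs map `φ`,
which exists as the limit of `λ⁻ⁿ (fⁿ - p)` in a chart (`exists_koenigs_plane`,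
`exists_isKoenigsMap`).

The object to study is a continuous section `ψ` of `φ` over a disk around `0`, with `ψ 0 = p`
(`IsSection`). The derivative of `φ` cannot vanish along such a section
(`deriv_ne_zero_of_continuous_rightInverse`), so that sections are unique, open, and
holomorphic. They glue to one over a disk of maximal radius `r ≤ ∞`
(`exists_maximal_isSection`), and satisfy `f (ψ w) = ψ (λ w)`.

The case `r = ∞` is excluded as follows. The section would be an injective holomorphic map from
the plane to the sphere; near infinity it is bounded in a suitable coordinate, so it extends
continuously to infinity, and its image omits at most one point. By the functional equation `f`
would be injective on this image, which is impossible in degree at least two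
(`not_injOn_ratMap_compl_singleton`).

If `r < ∞`, let `V` be the image of the open disk. Since `f` maps `V` into the compact set
`ψ(λ D̄)`, it maps the closure of `V` into `V`, so that this closure lies in the basin. A point `w`
of the bounding circle has a single preimage under `φ` in the closure of `V`: these preimages
form the cluster set of `ψ` at `w`, which is connected, and also lie in a finite fibre of `f`.
If the derivative of `φ` did not vanish on the closure of `V`, then `φ` would be injective and
open near this compact set, and `ψ` would extend to a larger disk. So it vanishes at a point `c`
of the frontier, and `f` is critical at `c` because `φ ∘ f = λ φ` while `φ` is regular at the
point `f c` of `V` (`IsKoenigsMap.exists_maximal_disk`).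

Conversely, any compact neighbourhood of `p` that `φ` maps bijectively to a closed disk is the
image of a section. Of two of them with different radii, the smaller one lies over the open
larger disk, where `φ` is regular, and so it cannot contain a critical point of `f`
(`IsKoenigsMap.disk_unique`).
-/

namespace RationalDynamics

/-! ### Charts of the Riemann sphere -/

@[simp] lemma chart_infty_infty : chart ∞ ∞ = 0 := rfl
@[simp] lemma chart_infty_coe (z : ℂ) : chart ∞ (z : OnePoint ℂ) = z⁻¹ := rfl
@[simp] lemma chart_coe_coe (z w : ℂ) : chart (z : OnePoint ℂ) (w : OnePoint ℂ) = w := rfl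
@[simp] lemma chartInv_coe (z w : ℂ) : chartInv (z : OnePoint ℂ) w = (w : OnePoint ℂ) := rfl
@[simp] lemma chartInv_infty_zero : chartInv ∞ 0 = ∞ := by simp [chartInv]
lemma chartInv_infty_of_ne {w : ℂ} (hw : w ≠ 0) : chartInv ∞ w = ((w⁻¹ : ℂ) : OnePoint ℂ) := by
  simp [chartInv, hw]

@[simp] lemma chart_chartInv (z : OnePoint ℂ) (w : ℂ) : chart z (chartInv z w) = w := by
  induction z using OnePoint.rec with
  | infty =>
    rcases eq_or_ne w 0 with rfl | hw
    · simp
    · simp [chartInv_infty_of_ne hw]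
  | coe z => rfl

@[simp] lemma chartInv_chart_self (z : OnePoint ℂ) : chartInv z (chart z z) = z := by
  induction z using OnePoint.rec with
  | infty => simp
  | coe z => rfl

/-- The involution `z ↦ 1 / z` of the Riemann sphere. -/
noncomputable def sphereInv : OnePoint ℂ → OnePoint ℂ
  | ∞ => ((0 : ℂ) : OnePoint ℂ)
  | (z : ℂ) => chartInv ∞ z

@[simp] lemma sphereInv_infty : sphereInv ∞ = ((0 : ℂ) : OnePoint ℂ) := rfl
@[simp] lemma sphereInv_coe (z : ℂ) : sphereInv (z : OnePoint ℂ) = chartInv ∞ z := rfl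

lemma sphereInv_involutive : Function.Involutive sphereInv := by
  intro z
  induction z using OnePoint.rec with
  | infty => simp
  | coe z =>
    rcases eq_or_ne z 0 with rfl | hz
    · simp
    · simp [chartInv_infty_of_ne hz, chartInv_infty_of_ne (inv_ne_zero hz)]

lemma eventually_ne_cobounded (a : ℂ) : ∀ᶠ w in Bornology.cobounded ℂ, w ≠ a :=
  Bornology.isBounded_def.1 (Bornology.isBounded_singleton (x := a))

lemma tendsto_coe_cobounded :
    Tendsto ((↑) : ℂ → OnePoint ℂ) (Bornology.cobounded ℂ) (𝓝 ∞) := by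
  have := OnePoint.tendsto_coe_infty (X := ℂ)
  rwa [Filter.coclosedCompact_eq_cocompact, ← Metric.cobounded_eq_cocompact] at this

lemma continuous_chartInv_infty : Continuous (chartInv ∞) := by
  rw [continuous_iff_continuousAt]
  intro w
  rcases eq_or_ne w 0 with rfl | hw
  · rw [continuousAt_iff_punctured_nhds, chartInv_infty_zero]
    refine (tendsto_coe_cobounded.comp tendsto_inv₀_nhdsNE_zero).congr' ?_
    filter_upwards [self_mem_nhdsWithin] with w hw
    exact (chartInv_infty_of_ne hw).symm
  · have : ContinuousAt (fun w : ℂ => ((w⁻¹ : ℂ) : OnePoint ℂ)) w :=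
      OnePoint.continuous_coe.continuousAt.comp (continuousAt_inv₀ hw)
    refine this.congr ?_
    filter_upwards [isOpen_ne.mem_nhds hw] with w hw
    exact (chartInv_infty_of_ne hw).symm

lemma continuous_sphereInv : Continuous sphereInv := by
  rw [continuous_iff_continuousAt]
  intro z
  induction z using OnePoint.rec with
  | infty =>
    rw [OnePoint.continuousAt_infty', Filter.coclosedCompact_eq_cocompact,
      ← Metric.cobounded_eq_cocompact, sphereInv_infty]
    refine ((OnePoint.continuous_coe.tendsto (0 : ℂ)).comp
      (tendsto_inv₀_cobounded (α := ℂ))).congr' ?_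
    filter_upwards [eventually_ne_cobounded 0] with w hw
    simp [chartInv_infty_of_ne hw]
  | coe z =>
    rw [OnePoint.continuousAt_coe]
    exact continuous_chartInv_infty.continuousAt

/-- The involution `z ↦ 1 / z` as a homeomorphism of the sphere. -/
noncomputable def sphereInvHomeomorph : OnePoint ℂ ≃ₜ OnePoint ℂ where
  toEquiv := sphereInv_involutive.toPerm
  continuous_toFun := continuous_sphereInv
  continuous_invFun := continuous_sphereInv

lemma isOpenEmbedding_chartInv (z : OnePoint ℂ) : IsOpenEmbedding (chartInv z) := by
  induction z using OnePoint.rec with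
  | infty => exact sphereInvHomeomorph.isOpenEmbedding.comp OnePoint.isOpenEmbedding_coe
  | coe z => exact OnePoint.isOpenEmbedding_coe

lemma map_chartInv_nhds (z : OnePoint ℂ) (w : ℂ) :
    map (chartInv z) (𝓝 w) = 𝓝 (chartInv z w) :=
  (isOpenEmbedding_chartInv z).map_nhds_eq w

lemma map_chartInv_nhds_self (z : OnePoint ℂ) : map (chartInv z) (𝓝 (chart z z)) = 𝓝 z := by
  rw [map_chartInv_nhds, chartInv_chart_self]

lemma eventually_nhds_iff_chartInv {z : OnePoint ℂ} {P : OnePoint ℂ → Prop} :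
    (∀ᶠ y in 𝓝 z, P y) ↔ ∀ᶠ w in 𝓝 (chart z z), P (chartInv z w) := by
  rw [← map_chartInv_nhds_self z, eventually_map]

lemma tendsto_chartInv_self (z : OnePoint ℂ) : Tendsto (chartInv z) (𝓝 (chart z z)) (𝓝 z) :=
  (map_chartInv_nhds_self z).le

lemma eventually_chartInv_chart (z : OnePoint ℂ) : ∀ᶠ y in 𝓝 z, chartInv z (chart z y) = y := by
  rw [eventually_nhds_iff_chartInv]
  simp

/-! ### Holomorphic functions and maps on the sphere -/

/-- The function `φ` is holomorphic at `z`, read in the chart around `z`. -/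
def HolAt (φ : OnePoint ℂ → ℂ) (z : OnePoint ℂ) : Prop :=
  AnalyticAt ℂ (fun w : ℂ => φ (chartInv z w)) (chart z z)

/-- The derivative of `φ` at `z`, read in the chart around `z`. -/
noncomputable def chartDeriv (φ : OnePoint ℂ → ℂ) (z : OnePoint ℂ) : ℂ :=
  deriv (fun w : ℂ => φ (chartInv z w)) (chart z z)

/-- The self-map `f` of the sphere is holomorphic at `z`: in the charts around `z` and `f z` it is
given by an analytic function `F`. -/
def HolMapAt (f : OnePoint ℂ → OnePoint ℂ) (z : OnePoint ℂ) : Prop :=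
  ∃ F : ℂ → ℂ, AnalyticAt ℂ F (chart z z) ∧ F (chart z z) = chart (f z) (f z) ∧
    ∀ᶠ w in 𝓝 (chart z z), f (chartInv z w) = chartInv (f z) (F w)

lemma HolAt.continuousAt {φ : OnePoint ℂ → ℂ} {z : OnePoint ℂ} (h : HolAt φ z) :
    ContinuousAt φ z := by
  rw [ContinuousAt, ← map_chartInv_nhds_self z, tendsto_map'_iff]
  have := AnalyticAt.continuousAt h
  rw [ContinuousAt, chartInv_chart_self] at this
  exact this

lemma HolAt.congr {φ χ : OnePoint ℂ → ℂ} {z : OnePoint ℂ} (h : HolAt φ z) (he : φ =ᶠ[𝓝 z] χ) :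
    HolAt χ z :=
  AnalyticAt.congr h (eventually_nhds_iff_chartInv.1 he)

lemma chartDeriv_congr {φ χ : OnePoint ℂ → ℂ} {z : OnePoint ℂ} (he : φ =ᶠ[𝓝 z] χ) :
    chartDeriv φ z = chartDeriv χ z :=
  (show (fun w : ℂ => φ (chartInv z w)) =ᶠ[𝓝 (chart z z)] fun w => χ (chartInv z w) from
    eventually_nhds_iff_chartInv.1 he).deriv_eq

lemma HolAt.const_mul {φ : OnePoint ℂ → ℂ} {z : OnePoint ℂ} (c : ℂ) (h : HolAt φ z) :
    HolAt (fun y => c * φ y) z :=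
  analyticAt_const.mul h

lemma HolAt.chartDeriv_const_mul {φ : OnePoint ℂ → ℂ} {z : OnePoint ℂ} (c : ℂ) (h : HolAt φ z) :
    chartDeriv (fun y => c * φ y) z = c * chartDeriv φ z :=
  deriv_const_mul c (AnalyticAt.differentiableAt h)

lemma HolMapAt.continuousAt {f : OnePoint ℂ → OnePoint ℂ} {z : OnePoint ℂ} (h : HolMapAt f z) :
    ContinuousAt f z := by
  obtain ⟨F, hF, hF0, hFe⟩ := h
  rw [ContinuousAt, ← map_chartInv_nhds_self z, tendsto_map'_iff]
  have h1 : Tendsto F (𝓝 (chart z z)) (𝓝 (chart (f z) (f z))) := hF0 ▸ hF.continuousAt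
  exact ((tendsto_chartInv_self (f z)).comp h1).congr' (hFe.mono fun w hw => hw.symm)

/-- In charts, a holomorphic self-map of the sphere is `fun w => chart (f z) (f (chartInv z w))`. -/
lemma HolMapAt.analyticAt {f : OnePoint ℂ → OnePoint ℂ} {z : OnePoint ℂ} (h : HolMapAt f z) :
    AnalyticAt ℂ (fun w => chart (f z) (f (chartInv z w))) (chart z z) := by
  obtain ⟨F, hF, hF0, hFe⟩ := h
  refine hF.congr (hFe.mono fun w hw => ?_)
  simp [hw]

lemma HolMapAt.comp_eventuallyEq {f : OnePoint ℂ → OnePoint ℂ} {z : OnePoint ℂ} (h : HolMapAt f z)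
    (φ : OnePoint ℂ → ℂ) :
    (fun w => φ (f (chartInv z w))) =ᶠ[𝓝 (chart z z)]
      (fun w => φ (chartInv (f z) w)) ∘ fun w => chart (f z) (f (chartInv z w)) := by
  obtain ⟨F, hF, hF0, hFe⟩ := h
  filter_upwards [hFe] with w hw
  simp [hw]

lemma HolAt.comp {f : OnePoint ℂ → OnePoint ℂ} {z : OnePoint ℂ} {φ : OnePoint ℂ → ℂ}
    (hφ : HolAt φ (f z)) (h : HolMapAt f z) : HolAt (fun y => φ (f y)) z := by
  refine AnalyticAt.congr (AnalyticAt.comp (f := fun w => chart (f z) (f (chartInv z w))) ?_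
    h.analyticAt) (h.comp_eventuallyEq φ).symm
  simpa [HolAt] using hφ

lemma HolAt.chartDeriv_comp {f : OnePoint ℂ → OnePoint ℂ} {z : OnePoint ℂ} {φ : OnePoint ℂ → ℂ}
    (hφ : HolAt φ (f z)) (h : HolMapAt f z) :
    chartDeriv (fun y => φ (f y)) z = chartDeriv φ (f z) * localDeriv f z := by
  rw [chartDeriv, (h.comp_eventuallyEq φ).deriv_eq, deriv_comp]
  · simp [chartDeriv, localDeriv]
  · simpa using AnalyticAt.differentiableAt hφ
  · exact h.analyticAt.differentiableAt

/-- The chart around `p` is a holomorphic function on its domain, the range of `chartInv p`. -/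
lemma holAt_chart (p : OnePoint ℂ) (w : ℂ) : HolAt (chart p) (chartInv p w) := by
  induction p using OnePoint.rec with
  | infty =>
    rcases eq_or_ne w 0 with rfl | hw
    · rw [chartInv_infty_zero]
      simpa [HolAt, Function.id_def] using analyticAt_id (𝕜 := ℂ) (E := ℂ)
    · rw [chartInv_infty_of_ne hw]
      simpa [HolAt] using analyticAt_inv (𝕝 := ℂ) (inv_ne_zero hw)
  | coe p => simpa [HolAt, Function.id_def] using analyticAt_id (𝕜 := ℂ) (E := ℂ)

/-! ### Rational maps -/

section RationalMaps

open Polynomial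

open scoped Classical in
/-- The point `x / y` of the sphere, equal to `∞` if `y = 0`. -/
noncomputable def sphereDiv (x y : ℂ) : OnePoint ℂ :=
  if y = 0 then ∞ else ((x / y : ℂ) : OnePoint ℂ)

lemma sphereDiv_zero (x : ℂ) : sphereDiv x 0 = ∞ := by simp [sphereDiv]

lemma sphereDiv_of_ne (x : ℂ) {y : ℂ} (hy : y ≠ 0) :
    sphereDiv x y = ((x / y : ℂ) : OnePoint ℂ) := by simp [sphereDiv, hy]

/-- A quotient of analytic functions without common zero is a holomorphic map into the sphere. -/
lemma holMapAt_of_sphereDiv {f : OnePoint ℂ → OnePoint ℂ} {z : OnePoint ℂ} {A B : ℂ → ℂ}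
    (hA : AnalyticAt ℂ A (chart z z)) (hB : AnalyticAt ℂ B (chart z z))
    (hAB : A (chart z z) ≠ 0 ∨ B (chart z z) ≠ 0)
    (hf : ∀ w, f (chartInv z w) = sphereDiv (A w) (B w)) : HolMapAt f z := by
  have hfz : f z = sphereDiv (A (chart z z)) (B (chart z z)) := by
    rw [← hf, chartInv_chart_self]
  by_cases hB0 : B (chart z z) = 0
  · have hA0 : A (chart z z) ≠ 0 := hAB.resolve_right (not_not.2 hB0)
    have hz : f z = ∞ := by rw [hfz, hB0, sphereDiv_zero]
    refine ⟨fun w => B w / A w, hB.div hA hA0, by simp [hB0, hz], ?_⟩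
    filter_upwards [hA.continuousAt.eventually_ne hA0] with w hw
    rw [hf, hz]
    by_cases hBw : B w = 0
    · simp [hBw, sphereDiv_zero]
    · rw [sphereDiv_of_ne _ hBw, chartInv_infty_of_ne (div_ne_zero hBw hw), inv_div]
  · have hz : f z = ((A (chart z z) / B (chart z z) : ℂ) : OnePoint ℂ) := by
      rw [hfz, sphereDiv_of_ne _ hB0]
    refine ⟨fun w => A w / B w, hA.div hB hB0, by rw [hz]; rfl, ?_⟩
    filter_upwards [hB.continuousAt.eventually_ne hB0] with w hw
    rw [hf, hz, sphereDiv_of_ne _ hw, chartInv_coe]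

lemma ratMap_coe (R : RatFunc ℂ) (z : ℂ) :
    ratMap R (z : OnePoint ℂ) = sphereDiv (R.num.eval z) (R.denom.eval z) := rfl

lemma eval_reflect_inv_mul_pow (P : ℂ[X]) {d : ℕ} (hd : P.natDegree ≤ d) {w : ℂ} (hw : w ≠ 0) :
    (reflect d P).eval w = P.eval w⁻¹ * w ^ d := by
  have : Invertible w⁻¹ := invertibleOfNonzero (inv_ne_zero hw)
  have h := eval₂_reflect_mul_pow (RingHom.id ℂ) w⁻¹ d P hd
  rw [invOf_eq_inv, inv_inv] at h
  change (reflect d P).eval w * w⁻¹ ^ d = P.eval w⁻¹ at h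
  rw [← h, mul_assoc, ← mul_pow, inv_mul_cancel₀ hw, one_pow, mul_one]

lemma eval_reflect_zero (P : ℂ[X]) (d : ℕ) : (reflect d P).eval 0 = P.coeff d := by
  rw [← coeff_zero_eq_eval_zero, coeff_reflect]
  simp

lemma num_denom_not_both_zero (R : RatFunc ℂ) (z : ℂ) :
    R.num.eval z ≠ 0 ∨ R.denom.eval z ≠ 0 := by
  by_contra! h
  obtain ⟨a, b, hab⟩ := R.isCoprime_num_denom
  have := congrArg (Polynomial.eval z) hab
  simp [h.1, h.2] at this

lemma coeff_ratDegree_not_both_zero (R : RatFunc ℂ) :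
    R.num.coeff (ratDegree R) ≠ 0 ∨ R.denom.coeff (ratDegree R) ≠ 0 := by
  rcases le_or_gt R.num.natDegree R.denom.natDegree with h | h
  · right
    rw [ratDegree, max_eq_right h]
    simpa using R.denom_ne_zero
  · left
    rw [ratDegree, max_eq_left h.le]
    have : R.num ≠ 0 := by
      rintro h0
      simp [h0] at h
    simpa using this

lemma ratMap_chartInv_infty (R : RatFunc ℂ) (w : ℂ) :
    ratMap R (chartInv ∞ w) = sphereDiv ((reflect (ratDegree R) R.num).eval w)
      ((reflect (ratDegree R) R.denom).eval w) := by
  rcases eq_or_ne w 0 with rfl | hw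
  · rw [chartInv_infty_zero, eval_reflect_zero, eval_reflect_zero]
    rcases lt_or_ge R.denom.natDegree R.num.natDegree with h | h
    · have h0 : R.denom.coeff (ratDegree R) = 0 :=
        coeff_eq_zero_of_natDegree_lt (by rw [ratDegree, max_eq_left h.le]; exact h)
      rw [h0, sphereDiv_zero]
      simp [ratMap, h]
    · have h0 : R.denom.coeff (ratDegree R) = R.denom.leadingCoeff := by
        rw [ratDegree, max_eq_right h, leadingCoeff]
      have h1 : R.denom.leadingCoeff ≠ 0 := by simpa using R.denom_ne_zero
      rw [h0, sphereDiv_of_ne _ h1]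
      simp [ratMap, not_lt.2 h, ratDegree, max_eq_right h]
  · rw [chartInv_infty_of_ne hw, ratMap_coe,
      eval_reflect_inv_mul_pow (d := ratDegree R) _ (le_max_left _ _) hw,
      eval_reflect_inv_mul_pow (d := ratDegree R) _ (le_max_right _ _) hw]
    have hwd : w ^ ratDegree R ≠ 0 := pow_ne_zero _ hw
    by_cases hq : R.denom.eval w⁻¹ = 0
    · simp [hq, sphereDiv_zero]
    · rw [sphereDiv_of_ne _ hq, sphereDiv_of_ne _ (mul_ne_zero hq hwd),
        mul_div_mul_right _ _ hwd]

lemma analyticAt_polynomial_eval (P : ℂ[X]) (a : ℂ) : AnalyticAt ℂ (fun w => P.eval w) a :=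
  (P.differentiable.analyticAt a)

/-- A rational map is holomorphic at every point of the sphere. -/
lemma holMapAt_ratMap (R : RatFunc ℂ) (z : OnePoint ℂ) : HolMapAt (ratMap R) z := by
  induction z using OnePoint.rec with
  | infty =>
    refine holMapAt_of_sphereDiv (analyticAt_polynomial_eval _ _) (analyticAt_polynomial_eval _ _)
      ?_ (ratMap_chartInv_infty R)
    simp only [chart_infty_infty, eval_reflect_zero]
    exact coeff_ratDegree_not_both_zero R
  | coe z =>
    exact holMapAt_of_sphereDiv (analyticAt_polynomial_eval R.num z)
      (analyticAt_polynomial_eval R.denom z) (num_denom_not_both_zero R z) (ratMap_coe R)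

lemma ratMap_coe_eq_coe_iff (R : RatFunc ℂ) (z v : ℂ) :
    ratMap R (z : OnePoint ℂ) = (v : OnePoint ℂ) ↔ (R.num - C v * R.denom).IsRoot z := by
  rw [ratMap_coe, IsRoot.def, eval_sub, eval_mul, eval_C, sub_eq_zero]
  by_cases hq : R.denom.eval z = 0
  · have := (num_denom_not_both_zero R z).resolve_right (not_not.2 hq)
    simp [hq, sphereDiv_zero, this]
  · rw [sphereDiv_of_ne _ hq, OnePoint.coe_eq_coe, div_eq_iff hq]

/-- If `P - v Q = 0` then, `P / Q` being in lowest terms, `Q` is constant, and so is `P`. -/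
lemma num_sub_C_mul_denom_ne_zero {R : RatFunc ℂ} (hR : 1 ≤ ratDegree R) (v : ℂ) :
    R.num - C v * R.denom ≠ 0 := by
  intro h
  rw [sub_eq_zero] at h
  have hu : IsUnit R.denom := by
    refine R.isCoprime_num_denom.isUnit_of_dvd' ?_ dvd_rfl
    rw [h]
    exact dvd_mul_left _ _
  have h0 : R.denom.natDegree = 0 := natDegree_eq_zero_of_isUnit hu
  have h1 : R.num.natDegree ≤ 0 := by
    rw [h, ← h0]
    exact natDegree_C_mul_le _ _
  rw [ratDegree, h0] at hR
  omega

/-- The fibres of a nonconstant rational map are finite. -/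
lemma finite_ratMap_fiber {R : RatFunc ℂ} (hR : 1 ≤ ratDegree R) (y : OnePoint ℂ) :
    {z | ratMap R z = y}.Finite := by
  have key : {z : ℂ | ratMap R (z : OnePoint ℂ) = y}.Finite := by
    induction y using OnePoint.rec with
    | infty =>
      refine (finite_setOfPred_isRoot R.denom_ne_zero).subset fun z hz => ?_
      simp only [Set.mem_ofPred_eq, ratMap_coe, IsRoot.def] at hz ⊢
      by_contra hq
      rw [sphereDiv_of_ne _ hq] at hz
      exact OnePoint.coe_ne_infty _ hz
    | coe v =>
      refine (finite_setOfPred_isRoot (num_sub_C_mul_denom_ne_zero hR v)).subset fun z hz => ?_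
      exact (ratMap_coe_eq_coe_iff R z v).1 hz
  refine ((key.image ((↑) : ℂ → OnePoint ℂ)).union (Set.finite_singleton ∞)).subset fun z hz => ?_
  induction z using OnePoint.rec with
  | infty => exact Or.inr rfl
  | coe z => exact Or.inl ⟨z, hz, rfl⟩

/-- A rational map `P / Q` of degree at least two is not injective off a point `L`. Otherwise, for
all but finitely many `v`, the polynomial `P - v Q` has a single root, which is multiple because the
degree is at least two, and so is a zero of `P' Q - P Q'`; this polynomial would then vanish. -/
lemma not_injOn_ratMap_compl_singleton {R : RatFunc ℂ} (hR : 2 ≤ ratDegree R) (L : OnePoint ℂ) :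
    ¬ Set.InjOn (ratMap R) {L}ᶜ := by
  intro hinj
  set P := R.num
  set Q := R.denom
  set d := ratDegree R
  set W : ℂ[X] := derivative P * Q - P * derivative Q with hW
  -- The values to avoid: those where the degree of `P - v Q` drops, and `f L`.
  let E : Set ℂ := {v | P.coeff d - v * Q.coeff d = 0} ∪ {v | (v : OnePoint ℂ) = ratMap R L}
  have hE : E.Finite := by
    refine Set.Finite.union (Set.Subsingleton.finite ?_) (Set.Subsingleton.finite ?_)
    · intro v hv w hw
      simp only [Set.mem_ofPred_eq] at hv hw
      have hQ : Q.coeff d ≠ 0 := by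
        intro hQ
        rw [hQ, mul_zero, sub_zero] at hv
        exact (coeff_ratDegree_not_both_zero R).elim (fun h => h hv) (fun h => h hQ)
      exact mul_right_cancel₀ hQ (by linear_combination hw - hv)
    · intro v hv w hw
      exact OnePoint.coe_injective (hv.trans hw.symm)
  have hroot : ∀ v ∈ Eᶜ, ∃ a, W.IsRoot a ∧ ratMap R (a : OnePoint ℂ) = v := by
    intro v hv
    set p := P - C v * Q with hpdef
    have hp0 : p ≠ 0 := num_sub_C_mul_denom_ne_zero (by omega) v
    have hcoeff : p.coeff d ≠ 0 := by
      rw [hpdef, coeff_sub, coeff_C_mul]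
      exact fun h => hv (Or.inl h)
    have hdeg : 2 ≤ p.natDegree := hR.trans (le_natDegree_of_ne_zero hcoeff)
    have hneL : ∀ a, p.IsRoot a → (a : OnePoint ℂ) ∈ ({L}ᶜ : Set (OnePoint ℂ)) := by
      intro a ha haL
      refine hv (Or.inr ?_)
      rw [Set.mem_singleton_iff] at haL
      simp only [Set.mem_ofPred_eq]
      rw [← haL, (ratMap_coe_eq_coe_iff R a v).2 ha]
    have huniq : ∀ a b, p.IsRoot a → p.IsRoot b → b = a := by
      intro a b ha hb
      refine OnePoint.coe_injective (hinj (hneL b hb) (hneL a ha) ?_)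
      rw [(ratMap_coe_eq_coe_iff R a v).2 ha, (ratMap_coe_eq_coe_iff R b v).2 hb]
    have hcard : p.roots.card = p.natDegree :=
      (splits_iff_card_roots.1 (IsAlgClosed.splits p))
    obtain ⟨a, ha⟩ := IsAlgClosed.exists_root p (by
      rw [degree_eq_natDegree hp0]
      exact_mod_cast (by omega : p.natDegree ≠ 0))
    have hmult : 1 < p.rootMultiplicity a := by
      have : p.roots = Multiset.replicate p.roots.card a :=
        Multiset.eq_replicate_card.2 fun b hb => huniq a b ha (isRoot_of_mem_roots hb)
      rw [← count_roots, this, Multiset.count_replicate_self, hcard]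
      omega
    have hder := ((one_lt_rootMultiplicity_iff_isRoot hp0).1 hmult).2
    refine ⟨a, ?_, (ratMap_coe_eq_coe_iff R a v).2 ha⟩
    have h1 : P.eval a = v * Q.eval a := by
      have := ha
      rw [IsRoot.def, hpdef, eval_sub, eval_mul, eval_C, sub_eq_zero] at this
      exact this
    have h2 : (derivative P).eval a = v * (derivative Q).eval a := by
      have := hder
      rw [IsRoot.def, hpdef, derivative_sub, derivative_C_mul, eval_sub, eval_mul, eval_C,
        sub_eq_zero] at this
      exact this
    rw [IsRoot.def, hW, eval_sub, eval_mul, eval_mul, h1, h2]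
    ring
  have hW0 : W = 0 := by
    by_contra hW0
    choose! g hg1 hg2 using hroot
    have hinf : (g '' Eᶜ).Infinite := by
      refine (hE.infinite_compl).image fun v hv w hw hvw => ?_
      have := hg2 v hv
      rw [hvw, hg2 w hw] at this
      exact OnePoint.coe_injective this.symm
    refine hinf ((finite_setOfPred_isRoot hW0).subset ?_)
    rintro _ ⟨v, hv, rfl⟩
    exact hg1 v hv
  have hder : derivative P * Q = P * derivative Q := sub_eq_zero.1 hW0
  have hcop : IsCoprime P Q := R.isCoprime_num_denom
  have hQ' : derivative Q = 0 := by
    by_contra h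
    have hdvd : Q ∣ derivative Q := hcop.symm.dvd_of_dvd_mul_left (hder ▸ dvd_mul_left _ _)
    have h1 : Q.natDegree ≠ 0 := fun h0 => h (derivative_of_natDegree_zero h0)
    exact absurd (natDegree_le_of_dvd hdvd h) (not_le.2 (natDegree_derivative_lt h1))
  have hP' : derivative P = 0 := by
    rw [hQ', mul_zero] at hder
    exact (mul_eq_zero.1 hder).resolve_right R.denom_ne_zero
  have h1 : P.natDegree = 0 := derivative_eq_zero.1 hP'
  have h2 : Q.natDegree = 0 := derivative_eq_zero.1 hQ'
  have h3 : ratDegree R = max P.natDegree Q.natDegree := rfl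
  omega

end RationalMaps

/-! ### Linearization near an attracting fixed point -/

/-- **Koenigs linearization** in the plane. If `F a = a` and `0 < ‖F' a‖ < 1`, then the functions
`(F' a)⁻ⁿ (Fⁿ - a)` converge on a ball around `a` on which a given eventual property `P` holds. -/
lemma exists_koenigs_plane {F : ℂ → ℂ} {a lam : ℂ} (hF : AnalyticAt ℂ F a) (hFa : F a = a)
    (hder : deriv F a = lam) (hlam0 : lam ≠ 0) (hlam1 : ‖lam‖ < 1) {P : ℂ → Prop}
    (hP : ∀ᶠ w in 𝓝 a, P w) :
    ∃ ρ > 0, ∃ φ : ℂ → ℂ, DifferentiableOn ℂ φ (Metric.ball a ρ) ∧ deriv φ a = 1 ∧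
      ∀ w ∈ Metric.ball a ρ, P w ∧ F w ∈ Metric.ball a ρ ∧
        Tendsto (fun n : ℕ => F^[n] w) atTop (𝓝 a) ∧
        Tendsto (fun n : ℕ => (lam ^ n)⁻¹ * (F^[n] w - a)) atTop (𝓝 (φ w)) := by
  have hl : 0 < ‖lam‖ := norm_pos_iff.2 hlam0
  -- A contraction rate `c` with `c ^ 2 < ‖lam‖`, so that the quadratic error terms are summable.
  obtain ⟨c, hc1, hc2⟩ : ∃ c, ‖lam‖ < c ∧ c < √‖lam‖ :=
    exists_between (Real.lt_sqrt_of_sq_lt (by nlinarith))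
  have hc0 : 0 < c := hl.trans hc1
  have hcsq : c ^ 2 < ‖lam‖ := (Real.lt_sqrt hc0.le).1 hc2
  have hclt : c < 1 := by nlinarith
  have hFd : HasDerivAt F lam a := hder ▸ hF.differentiableAt.hasDerivAt
  have hcontr : ∀ᶠ w in 𝓝 a, ‖F w - a‖ ≤ c * ‖w - a‖ := by
    have := hFd.isLittleO.def (sub_pos.2 hc1)
    filter_upwards [this] with w hw
    rw [hFa, smul_eq_mul] at hw
    have h1 : F w - a = (F w - a - (w - a) * lam) + (w - a) * lam := by ring
    rw [h1]
    refine (norm_add_le _ _).trans ?_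
    rw [norm_mul]
    linarith
  obtain ⟨K, hK0, hquad⟩ : ∃ K > 0, ∀ᶠ w in 𝓝 a, ‖F w - a - lam * (w - a)‖ ≤ K * ‖w - a‖ ^ 2 := by
    have hds : DifferentiableAt ℂ (dslope F a) a := by
      obtain ⟨s, hs, hsF⟩ := hF.eventually_analyticAt.exists_mem
      have h2 : DifferentiableOn ℂ (dslope F a) s :=
        (Complex.differentiableOn_dslope hs).2
          fun w hw => (hsF w hw).differentiableAt.differentiableWithinAt
      exact h2.differentiableAt hs
    obtain ⟨K, hK0, hK⟩ := hds.isBigO_sub.exists_pos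
    refine ⟨K, hK0, ?_⟩
    filter_upwards [hK.bound] with w hw
    have h1 : F w - a - lam * (w - a) = (w - a) * (dslope F a w - dslope F a a) := by
      have := sub_smul_dslope F a w
      rw [smul_eq_mul, hFa] at this
      rw [dslope_same, hder]
      linear_combination -this
    rw [h1, norm_mul]
    nlinarith [norm_nonneg (w - a)]
  obtain ⟨ρ, hρ, hball⟩ := Metric.eventually_nhds_iff_ball.1
    ((hP.and hF.eventually_analyticAt).and (hcontr.and hquad))
  have hmaps : ∀ w ∈ Metric.ball a ρ, F w ∈ Metric.ball a ρ := by
    intro w hw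
    have h1 := (hball w hw).2.1
    rw [mem_ball_iff_norm] at hw ⊢
    nlinarith [norm_nonneg (w - a)]
  have hiter : ∀ n : ℕ, ∀ w ∈ Metric.ball a ρ, F^[n] w ∈ Metric.ball a ρ ∧
      ‖F^[n] w - a‖ ≤ c ^ n * ρ := by
    intro n w hw
    induction n with
    | zero => exact ⟨hw, by simpa using (mem_ball_iff_norm.1 hw).le⟩
    | succ n ih =>
      rw [Function.iterate_succ_apply']
      refine ⟨hmaps _ ih.1, ((hball _ ih.1).2.1).trans ?_⟩
      rw [pow_succ']
      nlinarith [ih.2]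
  have hdiff : ∀ n : ℕ, DifferentiableOn ℂ (F^[n]) (Metric.ball a ρ) := by
    intro n
    induction n with
    | zero => exact differentiableOn_id
    | succ n ih =>
      rw [Function.iterate_succ']
      exact DifferentiableOn.comp (t := Metric.ball a ρ)
        (fun w hw => (hball w hw).1.2.differentiableAt.differentiableWithinAt) ih
        fun w hw => (hiter n w hw).1
  let u : ℕ → ℂ → ℂ := fun n w => (lam ^ n)⁻¹ * (F^[n] w - a)
  let M : ℕ → ℝ := fun n => K * ρ ^ 2 / ‖lam‖ * (c ^ 2 / ‖lam‖) ^ n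
  have hM : Summable M :=
    (summable_geometric_of_lt_one (by positivity) ((div_lt_one hl).2 hcsq)).mul_left _
  have hbound : ∀ n, ∀ w ∈ Metric.ball a ρ, ‖u (n + 1) w - u n w‖ ≤ M n := by
    intro n w hw
    obtain ⟨h1, h2⟩ := hiter n w hw
    have h3 := (hball _ h1).2.2
    have h4 : u (n + 1) w - u n w =
        (lam ^ (n + 1))⁻¹ * (F (F^[n] w) - a - lam * (F^[n] w - a)) := by
      simp only [u, Function.iterate_succ_apply']
      field_simp
      ring
    rw [h4, norm_mul, norm_inv, norm_pow]
    have h5 : K * ‖F^[n] w - a‖ ^ 2 ≤ K * (c ^ n * ρ) ^ 2 := by gcongr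
    calc (‖lam‖ ^ (n + 1))⁻¹ * ‖F (F^[n] w) - a - lam * (F^[n] w - a)‖
        ≤ (‖lam‖ ^ (n + 1))⁻¹ * (K * (c ^ n * ρ) ^ 2) := by gcongr; exact h3.trans h5
      _ = M n := by
        simp only [M]
        rw [div_pow]
        field_simp
        ring
  have hunif := tendstoUniformlyOn_tsum_nat hM hbound
  let φ : ℂ → ℂ := fun w => (w - a) + ∑' n, (u (n + 1) w - u n w)
  have hu0 : ∀ w, u 0 w = w - a := fun w => by simp [u]
  have htend : TendstoUniformlyOn u φ atTop (Metric.ball a ρ) := by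
    rw [Metric.tendstoUniformlyOn_iff] at hunif ⊢
    intro ε hε
    filter_upwards [hunif ε hε] with n hn w hw
    have := hn w hw
    rw [Finset.sum_range_sub (fun k => u k w) n, hu0] at this
    have h2 : φ w - u n w = (∑' n, (u (n + 1) w - u n w)) - (u n w - (w - a)) := by
      simp only [φ]; ring
    rw [dist_eq_norm, h2, ← dist_eq_norm]
    exact this
  have hud : ∀ n, DifferentiableOn ℂ (u n) (Metric.ball a ρ) := fun n =>
    ((hdiff n).sub_const a).const_mul _
  have hloc := htend.tendstoLocallyUniformlyOn
  have ha : a ∈ Metric.ball a ρ := Metric.mem_ball_self hρ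
  refine ⟨ρ, hρ, φ, hloc.differentiableOn (Eventually.of_forall hud) Metric.isOpen_ball, ?_, ?_⟩
  · have h1 := (hloc.deriv (Eventually.of_forall hud) Metric.isOpen_ball).tendsto_at ha
    have h2 : ∀ n, deriv (u n) a = 1 := by
      intro n
      have h3 : HasDerivAt (u n) ((lam ^ n)⁻¹ * lam ^ n) a :=
        ((HasDerivAt.iterate a hFd hFa n).sub_const a).const_mul _
      rw [h3.deriv, inv_mul_cancel₀ (pow_ne_zero _ hlam0)]
    simp only [Function.comp_def, h2] at h1
    exact tendsto_nhds_unique h1 tendsto_const_nhds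
  · intro w hw
    refine ⟨(hball w hw).1.1, hmaps w hw, ?_, htend.tendsto_at hw⟩
    rw [tendsto_iff_norm_sub_tendsto_zero]
    refine squeeze_zero (fun n => norm_nonneg _) (fun n => (hiter n w hw).2) ?_
    simpa using (tendsto_pow_atTop_nhds_zero_of_lt_one hc0.le hclt).mul_const ρ

/-- Near an attracting fixed point of the sphere with nonzero multiplier there are an
open neighbourhood contained in the basin and a linearizing function on it. -/
lemma exists_koenigs_local {f : OnePoint ℂ → OnePoint ℂ} {p : OnePoint ℂ} (hf : HolMapAt f p)
    (hp : IsAttractingFixedPoint f p) (h0 : multiplier f p ≠ 0) :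
    ∃ N : Set (OnePoint ℂ), IsOpen N ∧ p ∈ N ∧ N ⊆ basin f p ∧ ∃ φ : OnePoint ℂ → ℂ,
      (∀ z ∈ N, HolAt φ z) ∧ chartDeriv φ p = 1 ∧
      ∀ z ∈ N, Tendsto (fun n : ℕ => (multiplier f p ^ n)⁻¹ * (chart p (f^[n] z) - chart p p))
        atTop (𝓝 (φ z)) := by
  obtain ⟨hfp, hlam⟩ := hp
  set F : ℂ → ℂ := fun w => chart p (f (chartInv p w)) with hFdef
  have hF : AnalyticAt ℂ F (chart p p) := by simpa only [hfp] using hf.analyticAt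
  have hFe : ∀ᶠ w in 𝓝 (chart p p), f (chartInv p w) = chartInv p (F w) := by
    have h1 : Tendsto (fun w => f (chartInv p w)) (𝓝 (chart p p)) (𝓝 p) := by
      have := hf.continuousAt
      rw [ContinuousAt, hfp] at this
      exact this.comp (tendsto_chartInv_self p)
    filter_upwards [h1.eventually (eventually_chartInv_chart p)] with w hw
    exact hw.symm
  have hder : deriv F (chart p p) = multiplier f p := by
    simp only [multiplier, localDeriv, hfp, hFdef]
  obtain ⟨ρ, hρ, φ, hφd, hφ1, hφ⟩ := exists_koenigs_plane hF (by simp [hFdef, hfp]) hder h0 hlam hFe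
  have hiter : ∀ n : ℕ, ∀ w ∈ Metric.ball (chart p p) ρ,
      F^[n] w ∈ Metric.ball (chart p p) ρ ∧ f^[n] (chartInv p w) = chartInv p (F^[n] w) := by
    intro n w hw
    induction n with
    | zero => exact ⟨hw, rfl⟩
    | succ n ih =>
      rw [Function.iterate_succ_apply', Function.iterate_succ_apply', ih.2]
      exact ⟨(hφ _ ih.1).2.1, (hφ _ ih.1).1⟩
  refine ⟨chartInv p '' Metric.ball (chart p p) ρ,
    (isOpenEmbedding_chartInv p).isOpenMap _ Metric.isOpen_ball,
    ⟨chart p p, Metric.mem_ball_self hρ, chartInv_chart_self p⟩, ?_,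
    fun z => φ (chart p z), ?_, ?_, ?_⟩
  · rintro _ ⟨w, hw, rfl⟩
    refine ((tendsto_chartInv_self p).comp (hφ w hw).2.2.1).congr fun n => ?_
    exact (hiter n w hw).2.symm
  · rintro _ ⟨w, hw, rfl⟩
    refine AnalyticAt.comp (f := fun v => chart p (chartInv (chartInv p w) v)) (g := φ) ?_
      (holAt_chart p w)
    rw [chartInv_chart_self, chart_chartInv]
    exact hφd.analyticAt (Metric.isOpen_ball.mem_nhds hw)
  · simpa [chartDeriv] using hφ1
  · rintro _ ⟨w, hw, rfl⟩
    simp only [chart_chartInv]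
    refine (hφ w hw).2.2.2.congr fun n => ?_
    rw [(hiter n w hw).2, chart_chartInv]

lemma HolAt.comp_iterate {f : OnePoint ℂ → OnePoint ℂ} (hf : ∀ z, HolMapAt f z)
    {φ : OnePoint ℂ → ℂ} (k : ℕ) {z : OnePoint ℂ} (h : HolAt φ (f^[k] z)) :
    HolAt (fun y => φ (f^[k] y)) z := by
  induction k generalizing z with
  | zero => exact h
  | succ k ih => exact HolAt.comp (φ := fun y => φ (f^[k] y)) (ih h) (hf z)

section Basin

variable {f : OnePoint ℂ → OnePoint ℂ} {p : OnePoint ℂ}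

lemma map_mem_basin_iff {z : OnePoint ℂ} : f z ∈ basin f p ↔ z ∈ basin f p :=
  tendsto_add_atTop_iff_nat (f := fun n => f^[n] z) 1

lemma mem_basin_self (h : f p = p) : p ∈ basin f p := by
  simp [basin, Function.iterate_fixed h]

lemma exists_iterate_mem {N : Set (OnePoint ℂ)} (hN : IsOpen N) (hpN : p ∈ N) {z : OnePoint ℂ}
    (hz : z ∈ basin f p) : ∃ k, f^[k] z ∈ N :=
  (Tendsto.eventually hz (hN.mem_nhds hpN)).exists

lemma iterate_mem_basin_iff {z : OnePoint ℂ} (k : ℕ) : f^[k] z ∈ basin f p ↔ z ∈ basin f p := by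
  induction k generalizing z with
  | zero => rfl
  | succ k ih => rw [Function.iterate_succ_apply, ih, map_mem_basin_iff]

lemma isOpen_basin (hf : ∀ z, HolMapAt f z) (hp : IsAttractingFixedPoint f p)
    (h0 : multiplier f p ≠ 0) : IsOpen (basin f p) := by
  obtain ⟨N, hN, hpN, hNb, -⟩ := exists_koenigs_local (hf p) hp h0
  have hcont : Continuous f := continuous_iff_continuousAt.2 fun z => (hf z).continuousAt
  have : basin f p = ⋃ k : ℕ, f^[k] ⁻¹' N := by
    ext z
    simp only [Set.mem_iUnion, Set.mem_preimage]
    exact ⟨fun hz => exists_iterate_mem hN hpN hz,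
      fun ⟨k, hk⟩ => (iterate_mem_basin_iff k).1 (hNb hk)⟩
  rw [this]
  exact isOpen_iUnion fun k => hN.preimage (hcont.iterate k)

/-- The local linearization extends to the whole basin by the functional equation. -/
lemma exists_isKoenigsMap (hf : ∀ z, HolMapAt f z) (hp : IsAttractingFixedPoint f p)
    (h0 : multiplier f p ≠ 0) : ∃ φ, IsKoenigsMap f p φ := by
  obtain ⟨N, hN, hpN, hNb, φ₀, hφ₀, hφ₀', hlim⟩ := exists_koenigs_local (hf p) hp h0
  have hcont : Continuous f := continuous_iff_continuousAt.2 fun z => (hf z).continuousAt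
  set lam := multiplier f p
  let u : OnePoint ℂ → ℕ → ℂ := fun z n => (lam ^ n)⁻¹ * (chart p (f^[n] z) - chart p p)
  let φ : OnePoint ℂ → ℂ := fun z => limUnder atTop (u z)
  have hu : ∀ k z, f^[k] z ∈ N → Tendsto (u z) atTop (𝓝 ((lam ^ k)⁻¹ * φ₀ (f^[k] z))) := by
    intro k z hz
    rw [← tendsto_add_atTop_iff_nat k]
    refine ((hlim _ hz).const_mul (lam ^ k)⁻¹).congr fun n => ?_
    simp only [u]
    rw [Function.iterate_add_apply, pow_add, mul_inv]
    ring
  have hφ : ∀ k z, f^[k] z ∈ N → φ z = (lam ^ k)⁻¹ * φ₀ (f^[k] z) :=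
    fun k z hz => (hu k z hz).limUnder_eq
  refine ⟨φ, ?_, ?_, ?_⟩
  · intro z hz
    obtain ⟨k, hk⟩ := exists_iterate_mem hN hpN hz
    refine HolAt.congr (((hφ₀ _ hk).comp_iterate hf k).const_mul (lam ^ k)⁻¹) ?_
    filter_upwards [(hN.preimage (hcont.iterate k)).mem_nhds hk] with y hy
    exact (hφ k y hy).symm
  · intro z hz
    obtain ⟨k, hk⟩ := exists_iterate_mem hN hpN (map_mem_basin_iff.2 hz)
    have h1 : Tendsto (u (f z)) atTop (𝓝 (φ (f z))) := by
      rw [hφ k _ hk]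
      exact hu k _ hk
    have hk' : f^[k + 1] z ∈ N := hk
    have h2 : Tendsto (u z) atTop (𝓝 (φ z)) := by
      rw [hφ (k + 1) _ hk']
      exact hu (k + 1) _ hk'
    refine tendsto_nhds_unique h1
      ((((tendsto_add_atTop_iff_nat 1).2 h2).const_mul lam).congr fun n => ?_)
    simp only [u, Function.iterate_succ_apply]
    field_simp
    ring
  · have : chartDeriv φ p = chartDeriv φ₀ p := by
      refine chartDeriv_congr ?_
      filter_upwards [hN.mem_nhds hpN] with y hy
      simpa using hφ 0 y hy
    change chartDeriv φ p ≠ 0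
    rw [this, hφ₀']
    exact one_ne_zero

end Basin

/-! ### Local inversion of holomorphic functions -/

/-- A continuous local right inverse of an analytic function forces a nonzero derivative: off the
isolated zeros of the derivative it is differentiable, and these are removable singularities. -/
lemma deriv_ne_zero_of_continuous_rightInverse {g h : ℂ → ℂ} {w : ℂ} (hg : AnalyticAt ℂ g (h w))
    (hh : ∀ᶠ v in 𝓝 w, ContinuousAt h v ∧ g (h v) = v) : deriv g (h w) ≠ 0 := by
  intro h0
  have hinv : ∀ᶠ v in 𝓝 w, g (h v) = v := hh.mono fun v hv => hv.2
  have hcont : ContinuousAt h w := hh.self_of_nhds.1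
  have hw : g (h w) = w := hinv.self_of_nhds
  rcases hg.deriv.eventually_eq_zero_or_eventually_ne_zero with hz | hz
  · obtain ⟨ε, hε, hball⟩ := Metric.eventually_nhds_iff_ball.1 (hz.and hg.eventually_analyticAt)
    have hconst : ∀ᶠ v in 𝓝 w, v = w := by
      filter_upwards [hinv, hcont (Metric.ball_mem_nhds _ hε)] with v hv hvb
      rw [← hv]
      conv_rhs => rw [← hw]
      exact Metric.isOpen_ball.is_const_of_deriv_eq_zero (convex_ball _ _).isPreconnected
        (fun y hy => (hball y hy).2.differentiableAt.differentiableWithinAt)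
        (fun y hy => (hball y hy).1) hvb (Metric.mem_ball_self hε)
    have : {w} ∈ 𝓝 w := hconst
    exact not_isOpen_singleton w (isOpen_singleton_iff_nhds_eq_pure w |>.2
      (le_antisymm (by simpa using this) (pure_le_nhds w)))
  · have hd : ∀ᶠ v in 𝓝[≠] w, DifferentiableAt ℂ h v := by
      have h1 := hcont.eventually (eventually_nhdsWithin_iff.1 hz)
      have h2 := hcont.eventually hg.eventually_analyticAt
      rw [eventually_nhdsWithin_iff]
      filter_upwards [h1, h2, hh, hinv.eventually_nhds] with v h1 h2 h3 h4 hvw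
      have hne : h v ≠ h w := fun he => hvw (by
        rw [Set.mem_singleton_iff, ← h3.2, he, hw])
      exact (HasDerivAt.of_local_left_inverse h3.1 h2.differentiableAt.hasDerivAt
        (h1 hne) h4).differentiableAt
    have hda : DifferentiableAt ℂ h w :=
      (Complex.analyticAt_of_differentiable_on_punctured_nhds_of_continuousAt hd
        hcont).differentiableAt
    exact not_differentiableAt_of_local_left_inverse_hasDerivAt_zero
      (h0 ▸ hg.differentiableAt.hasDerivAt) hinv hda

/-- At a point where the derivative of `φ` does not vanish, `φ` is locally injective. -/
lemma HolAt.exists_injOn {φ : OnePoint ℂ → ℂ} {z : OnePoint ℂ} (h : HolAt φ z)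
    (h0 : chartDeriv φ z ≠ 0) : ∃ u ∈ 𝓝 z, Set.InjOn φ u := by
  have hs : HasStrictDerivAt (fun w => φ (chartInv z w)) (chartDeriv φ z) (chart z z) :=
    AnalyticAt.hasStrictDerivAt h
  obtain ⟨s, hs, hinj⟩ := (hs.eventually_left_inverse h0).exists_mem
  refine ⟨chartInv z '' s, ?_, ?_⟩
  · rw [← map_chartInv_nhds_self z]
    exact image_mem_map hs
  · rintro _ ⟨v, hv, rfl⟩ _ ⟨w, hw, rfl⟩ hvw
    rw [← hinj v hv, ← hinj w hw]
    exact congrArg _ (congrArg _ hvw)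

/-- Near a point where the derivative of `φ` does not vanish, `φ` is an open map. -/
lemma HolAt.eventually_map_nhds {φ : OnePoint ℂ → ℂ} {z : OnePoint ℂ} (h : HolAt φ z)
    (h0 : chartDeriv φ z ≠ 0) : ∀ᶠ y in 𝓝 z, map φ (𝓝 y) = 𝓝 (φ y) := by
  rw [eventually_nhds_iff_chartInv]
  have h1 : ∀ᶠ w in 𝓝 (chart z z), deriv (fun w => φ (chartInv z w)) w ≠ 0 :=
    (AnalyticAt.deriv h).continuousAt.eventually_ne h0
  filter_upwards [h1, AnalyticAt.eventually_analyticAt h] with w hw hwa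
  rw [← map_chartInv_nhds, map_map]
  exact hwa.hasStrictDerivAt.map_nhds_eq hw

/-- A function which is injective and open at each point of an open set has a continuous inverse. -/
lemma exists_continuousOn_inverse {X Y : Type*} [TopologicalSpace X] [TopologicalSpace Y]
    [Nonempty X] {φ : X → Y} {W : Set X} (hW : IsOpen W) (hinj : Set.InjOn φ W)
    (hopen : ∀ z ∈ W, map φ (𝓝 z) = 𝓝 (φ z)) :
    IsOpen (φ '' W) ∧ ∃ ψ : Y → X, ContinuousOn ψ (φ '' W) ∧ ∀ z ∈ W, ψ (φ z) = z := by
  have hleft : ∀ z ∈ W, Function.invFunOn φ W (φ z) = z := fun z hz =>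
    hinj.leftInvOn_invFunOn hz
  refine ⟨isOpen_iff_mem_nhds.2 ?_, Function.invFunOn φ W, ?_, hleft⟩
  · rintro _ ⟨z, hz, rfl⟩
    rw [← hopen z hz]
    exact image_mem_map (hW.mem_nhds hz)
  · rintro _ ⟨z, hz, rfl⟩
    refine ContinuousAt.continuousWithinAt ?_
    rw [ContinuousAt, hleft z hz, ← hopen z hz, tendsto_map'_iff]
    refine tendsto_id.congr' ?_
    filter_upwards [hW.mem_nhds hz] with y hy
    exact (hleft y hy).symm

/-- Two continuous lifts through `φ` agree on a connected open set if they agree at a point and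
`φ` is injective near each point of one of them. -/
lemma eqOn_of_comp_eq {A X Y : Type*} [TopologicalSpace A] [TopologicalSpace X] [T2Space X]
    {φ : X → Y} {S : Set A} (hS : IsOpen S) (hc : IsPreconnected S) {g₁ g₂ : A → X}
    (h₁ : ContinuousOn g₁ S) (h₂ : ContinuousOn g₂ S)
    (hinj : ∀ w ∈ S, ∃ u ∈ 𝓝 (g₁ w), Set.InjOn φ u) (he : ∀ w ∈ S, φ (g₁ w) = φ (g₂ w))
    {a : A} (ha : a ∈ S) (hag : g₁ a = g₂ a) : Set.EqOn g₁ g₂ S := by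
  have hu : IsOpen {w | w ∈ S ∧ g₁ w = g₂ w} := by
    rw [isOpen_iff_mem_nhds]
    rintro w ⟨hw, hgw⟩
    obtain ⟨u, hu, hui⟩ := hinj w hw
    have hc1 := h₁.continuousAt (hS.mem_nhds hw)
    have hc2 := h₂.continuousAt (hS.mem_nhds hw)
    filter_upwards [hS.mem_nhds hw, hc1 hu, hc2 (hgw ▸ hu)] with v hv h1 h2
    exact ⟨hv, hui h1 h2 (he v hv)⟩
  have hsub : S ⊆ {w | w ∈ S ∧ g₁ w = g₂ w} := by
    refine hc.subset_of_closure_inter_subset hu ⟨a, ha, ha, hag⟩ ?_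
    rintro w ⟨hwc, hw⟩
    refine ⟨hw, ?_⟩
    by_contra hne
    have hc1 := h₁.continuousAt (hS.mem_nhds hw)
    have hc2 := h₂.continuousAt (hS.mem_nhds hw)
    obtain ⟨v, hv, hv'⟩ := (mem_closure_iff_frequently.1 hwc).and_eventually
      ((hc1.prodMk_nhds hc2).eventually
        (isClosed_diagonal.isOpen_compl.mem_nhds hne)) |>.exists
    exact hv' hv.2
  exact fun w hw => (hsub hw).2

/-! ### Sections of a holomorphic function -/

/-- A continuous section of `φ` over `B`, with values in `Ω` and sending `0` to `p`. -/
structure IsSection (φ : OnePoint ℂ → ℂ) (Ω : Set (OnePoint ℂ)) (p : OnePoint ℂ) (B : Set ℂ)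
    (ψ : ℂ → OnePoint ℂ) : Prop where
  continuousOn : ContinuousOn ψ B
  mem : ∀ w ∈ B, ψ w ∈ Ω
  right_inv : ∀ w ∈ B, φ (ψ w) = w
  zero : ψ 0 = p

section Sections

variable {φ : OnePoint ℂ → ℂ} {Ω : Set (OnePoint ℂ)} {p : OnePoint ℂ} {B : Set ℂ}
  {ψ : ℂ → OnePoint ℂ}

lemma IsSection.mono (h : IsSection φ Ω p B ψ) {B' : Set ℂ} (hB : B' ⊆ B) :
    IsSection φ Ω p B' ψ :=
  ⟨h.continuousOn.mono hB, fun w hw => h.mem w (hB hw), fun w hw => h.right_inv w (hB hw), h.zero⟩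

lemma IsSection.congr (h : IsSection φ Ω p B ψ) {χ : ℂ → OnePoint ℂ} (he : Set.EqOn χ ψ B)
    (h0 : χ 0 = p) : IsSection φ Ω p B χ :=
  ⟨h.continuousOn.congr he, fun w hw => he hw ▸ h.mem w hw,
    fun w hw => by rw [he hw, h.right_inv w hw], h0⟩

lemma IsSection.continuousAt (h : IsSection φ Ω p B ψ) (hB : IsOpen B) {w : ℂ} (hw : w ∈ B) :
    ContinuousAt ψ w :=
  h.continuousOn.continuousAt (hB.mem_nhds hw)

lemma IsSection.eventually_continuousAt_chart (h : IsSection φ Ω p B ψ) (hB : IsOpen B) {w : ℂ}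
    (hw : w ∈ B) :
    ∀ᶠ v in 𝓝 w, chartInv (ψ w) (chart (ψ w) (ψ v)) = ψ v ∧
      ContinuousAt (fun v => chart (ψ w) (ψ v)) v := by
  have h1 := (h.continuousAt hB hw).eventually (eventually_chartInv_chart (ψ w))
  filter_upwards [h1, hB.mem_nhds hw] with v hv hvB
  have hc : ContinuousAt (chart (ψ w)) (ψ v) := by
    have := (holAt_chart (ψ w) (chart (ψ w) (ψ v))).continuousAt
    rwa [hv] at this
  exact ⟨hv, ContinuousAt.comp (f := ψ) hc (h.continuousAt hB hvB)⟩

/-- The derivative of `φ` does not vanish along a continuous section over an open set. -/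
lemma IsSection.chartDeriv_ne_zero (h : IsSection φ Ω p B ψ) (hB : IsOpen B)
    (hφ : ∀ z ∈ Ω, HolAt φ z) {w : ℂ} (hw : w ∈ B) : chartDeriv φ (ψ w) ≠ 0 := by
  refine deriv_ne_zero_of_continuous_rightInverse (h := fun v => chart (ψ w) (ψ v))
    (hφ _ (h.mem w hw)) ?_
  filter_upwards [h.eventually_continuousAt_chart hB hw, hB.mem_nhds hw] with v hv hvB
  exact ⟨hv.2, by rw [hv.1, h.right_inv v hvB]⟩

/-- A section over an open set is a holomorphic map: it is differentiable in charts. -/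
lemma IsSection.differentiableAt_chart (h : IsSection φ Ω p B ψ) (hB : IsOpen B)
    (hφ : ∀ z ∈ Ω, HolAt φ z) {w : ℂ} (hw : w ∈ B) :
    DifferentiableAt ℂ (fun v => chart (ψ w) (ψ v)) w := by
  have h1 := h.eventually_continuousAt_chart hB hw
  refine (HasDerivAt.of_local_left_inverse (f := fun v => φ (chartInv (ψ w) v))
    h1.self_of_nhds.2 (AnalyticAt.differentiableAt (hφ _ (h.mem w hw))).hasDerivAt
    (h.chartDeriv_ne_zero hB hφ hw) ?_).differentiableAt
  filter_upwards [h1, hB.mem_nhds hw] with v hv hvB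
  rw [hv.1, h.right_inv v hvB]

lemma IsSection.exists_injOn (h : IsSection φ Ω p B ψ) (hB : IsOpen B)
    (hφ : ∀ z ∈ Ω, HolAt φ z) {w : ℂ} (hw : w ∈ B) : ∃ u ∈ 𝓝 (ψ w), Set.InjOn φ u :=
  (hφ _ (h.mem w hw)).exists_injOn (h.chartDeriv_ne_zero hB hφ hw)

lemma IsSection.injOn (h : IsSection φ Ω p B ψ) : Set.InjOn ψ B := fun v hv w hw hvw => by
  rw [← h.right_inv v hv, hvw, h.right_inv w hw]

/-- A section over an open set is an open map. -/
lemma IsSection.isOpen_image (h : IsSection φ Ω p B ψ) (hB : IsOpen B)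
    (hφ : ∀ z ∈ Ω, HolAt φ z) : IsOpen (ψ '' B) := by
  rw [isOpen_iff_mem_nhds]
  rintro _ ⟨w, hw, rfl⟩
  obtain ⟨u, hu, hinj⟩ := h.exists_injOn hB hφ hw
  have hc : ContinuousAt φ (ψ w) := (hφ _ (h.mem w hw)).continuousAt
  have hc' : Tendsto φ (𝓝 (ψ w)) (𝓝 w) := by
    simpa only [ContinuousAt, h.right_inv w hw] using hc
  have h1 : ∀ᶠ v in 𝓝 w, v ∈ B ∧ ψ v ∈ u :=
    (hB.eventually_mem hw).and (h.continuousAt hB hw hu)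
  filter_upwards [hu, hc'.eventually h1] with y hy hy'
  exact ⟨φ y, hy'.1, hinj hy'.2 hy (h.right_inv _ hy'.1)⟩

lemma IsSection.eqOn_ball {r s : ℝ} (hφ : ∀ z ∈ Ω, HolAt φ z) {χ : ℂ → OnePoint ℂ}
    (h : IsSection φ Ω p (Metric.ball 0 r) ψ) (h' : IsSection φ Ω p (Metric.ball 0 s) χ)
    (hr : 0 < r) (hrs : r ≤ s) : Set.EqOn ψ χ (Metric.ball 0 r) := by
  have h'' := h'.mono (Metric.ball_subset_ball hrs)
  exact eqOn_of_comp_eq (φ := φ) Metric.isOpen_ball (convex_ball _ _).isPreconnected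
    h.continuousOn h''.continuousOn (fun w hw => h.exists_injOn Metric.isOpen_ball hφ hw)
    (fun w hw => by rw [h.right_inv w hw, h''.right_inv w hw]) (Metric.mem_ball_self hr)
    (by rw [h.zero, h'.zero])

/-- If `φ` has nonzero derivative along a compact set on which it is injective, and maps this set
onto a closed disk, then it has a section over a larger disk. The case `r = 0` of a single point is
the local inverse function theorem. -/
lemma exists_isSection_gt {K : Set (OnePoint ℂ)} {r : ℝ} (hr : 0 ≤ r) (hΩ : IsOpen Ω)
    (hφ : ∀ z ∈ Ω, HolAt φ z) (hK : IsCompact K) (hKΩ : K ⊆ Ω) (hinj : Set.InjOn φ K)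
    (himg : Metric.closedBall 0 r ⊆ φ '' K) (hreg : ∀ z ∈ K, chartDeriv φ z ≠ 0)
    (hp : p ∈ K) (hp0 : φ p = 0) :
    ∃ s > r, ∃ ψ, IsSection φ Ω p (Metric.ball 0 s) ψ := by
  obtain ⟨t, ht, htinj⟩ := hinj.exists_mem_nhdsSet hK
    (fun z hz => (hφ z (hKΩ hz)).continuousAt)
    (fun z hz => (hφ z (hKΩ hz)).exists_injOn (hreg z hz))
  have hev : ∀ᶠ y in 𝓝ˢ K, y ∈ t ∧ y ∈ Ω ∧ map φ (𝓝 y) = 𝓝 (φ y) := by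
    refine Eventually.and ht (eventually_nhdsSet_iff_forall.2 fun z hz => ?_)
    exact (hΩ.eventually_mem (hKΩ hz)).and ((hφ z (hKΩ hz)).eventually_map_nhds (hreg z hz))
  obtain ⟨W, hW, hKW, hWt⟩ := mem_nhdsSet_iff_exists.1 hev
  obtain ⟨hopen, ψ, hψc, hψ⟩ := exists_continuousOn_inverse hW
    (htinj.mono fun y hy => (hWt hy).1) (fun y hy => (hWt hy).2.2)
  have hsub : Metric.closedBall (0 : ℂ) r ⊆ φ '' W := himg.trans (Set.image_mono hKW)
  obtain ⟨δ, hδ, hthick⟩ :=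
    (isCompact_closedBall (0 : ℂ) r).exists_thickening_subset_open hopen hsub
  rw [thickening_closedBall hδ hr] at hthick
  refine ⟨δ + r, by linarith, ψ, hψc.mono hthick, ?_, ?_, ?_⟩
  · intro w hw
    obtain ⟨y, hy, rfl⟩ := hthick hw
    rw [hψ y hy]
    exact (hWt hy).2.1
  · intro w hw
    obtain ⟨y, hy, rfl⟩ := hthick hw
    rw [hψ y hy]
  · rw [← hp0, hψ p (hKW hp)]

/-- Sections over disks around `0` glue: there is a section over the whole plane, or over a disk of
maximal radius. -/
lemma exists_maximal_isSection (hΩ : IsOpen Ω) (hφ : ∀ z ∈ Ω, HolAt φ z) (hp : p ∈ Ω)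
    (hp0 : φ p = 0) (hp1 : chartDeriv φ p ≠ 0) :
    (∃ ψ, IsSection φ Ω p Set.univ ψ) ∨
      ∃ r > 0, (∃ ψ, IsSection φ Ω p (Metric.ball 0 r) ψ) ∧
        ∀ s > r, ¬ ∃ ψ, IsSection φ Ω p (Metric.ball 0 s) ψ := by
  let T : Set ℝ := {r | 0 < r ∧ ∃ ψ, IsSection φ Ω p (Metric.ball 0 r) ψ}
  obtain ⟨r₀, hr₀, hsec₀⟩ := exists_isSection_gt (K := {p}) le_rfl hΩ hφ isCompact_singleton
    (by simpa using hp) (Set.injOn_singleton _ _) (by simp [hp0]) (by simpa using hp1) rfl hp0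
  have hr₀T : r₀ ∈ T := ⟨hr₀, hsec₀⟩
  have hT : ∀ r ∈ T, ∃ ψ, IsSection φ Ω p (Metric.ball 0 r) ψ := fun r hr => hr.2
  choose! ψ hψ using hT
  classical
  let Ψ : ℂ → OnePoint ℂ := fun w => if h : ∃ r ∈ T, ‖w‖ < r then ψ h.choose w else p
  have hΨ : ∀ r ∈ T, Set.EqOn Ψ (ψ r) (Metric.ball 0 r) := by
    intro r hr w hw
    have h : ∃ r ∈ T, ‖w‖ < r := ⟨r, hr, mem_ball_zero_iff.1 hw⟩
    simp only [Ψ, dif_pos h]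
    obtain ⟨h1, h2⟩ := h.choose_spec
    rcases le_total h.choose r with hle | hle
    · exact (hψ _ h1).eqOn_ball hφ (hψ r hr) h1.1 hle (mem_ball_zero_iff.2 h2)
    · exact ((hψ r hr).eqOn_ball hφ (hψ _ h1) hr.1 hle hw).symm
  have hΨ0 : Ψ 0 = p := by
    rw [hΨ r₀ hr₀T (Metric.mem_ball_self hr₀), (hψ r₀ hr₀T).zero]
  have hsecT : ∀ r ∈ T, IsSection φ Ω p (Metric.ball 0 r) Ψ := fun r hr =>
    (hψ r hr).congr (hΨ r hr) hΨ0
  have hglue : ∀ B : Set ℂ, (∀ w ∈ B, ∃ r ∈ T, ‖w‖ < r) → IsSection φ Ω p B Ψ := by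
    intro B hB
    refine ⟨fun w hw => ?_, fun w hw => ?_, fun w hw => ?_, hΨ0⟩ <;>
      obtain ⟨r, hr, hwr⟩ := hB w hw <;>
      have hwr' := mem_ball_zero_iff.2 hwr
    · exact ((hsecT r hr).continuousAt Metric.isOpen_ball hwr').continuousWithinAt
    · exact (hsecT r hr).mem w hwr'
    · exact (hsecT r hr).right_inv w hwr'
  by_cases hb : BddAbove T
  · right
    refine ⟨sSup T, hr₀T.1.trans_le (le_csSup hb hr₀T), ⟨Ψ, hglue _ fun w hw => ?_⟩, ?_⟩
    · exact exists_lt_of_lt_csSup ⟨r₀, hr₀T⟩ (mem_ball_zero_iff.1 hw)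
    · intro s hs hsec
      have h0 : 0 < s := (hr₀T.1.trans_le (le_csSup hb hr₀T)).trans hs
      exact not_le.2 hs (le_csSup hb ⟨h0, hsec⟩)
  · left
    refine ⟨Ψ, hglue _ fun w _ => ?_⟩
    obtain ⟨r, hr, hlt⟩ := not_bddAbove_iff.1 hb ‖w‖
    exact ⟨r, hr, hlt⟩

end Sections

/-! ### Sections of a Koenigs map -/

/-- The cluster set of a function on a convex set `B` at a point is connected; hence it has at most
one point if it is contained in a finite set. -/
lemma mapClusterPt_unique_of_finite {X : Type*} [TopologicalSpace X] [CompactSpace X] [T2Space X]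
    {B : Set ℂ} (hB : Convex ℝ B) {w₀ : ℂ} {ψ : ℂ → X} (hψ : ContinuousOn ψ B) {E : Set X}
    (hE : E.Finite) (hsub : ∀ y, MapClusterPt y (𝓝[B] w₀) ψ → y ∈ E) {z₁ z₂ : X}
    (h₁ : MapClusterPt z₁ (𝓝[B] w₀) ψ) (h₂ : MapClusterPt z₂ (𝓝[B] w₀) ψ) : z₁ = z₂ := by
  by_contra hne
  -- Isolate `z₁` in `E` by a closed neighbourhood `t`, whose frontier misses `E`.
  have hE₁ : (E \ {z₁})ᶜ ∈ 𝓝 z₁ :=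
    hE.sdiff.isClosed.isOpen_compl.mem_nhds (by simp)
  obtain ⟨t, ht, htc, htE⟩ := exists_mem_nhds_isClosed_subset hE₁
  have hz₂t : z₂ ∉ t := fun h => htE h ⟨hsub _ h₂, fun h => hne (Set.mem_singleton_iff.1 h).symm⟩
  have hfreq : ∃ᶠ w in 𝓝[B] w₀, ψ w ∈ frontier t := by
    intro hev
    obtain ⟨ε, hε, hball⟩ := Metric.mem_nhdsWithin_iff.1 hev
    have hconn : IsPreconnected (ψ '' (Metric.ball w₀ ε ∩ B)) :=
      ((convex_ball w₀ ε).inter hB).isPreconnected.image _ (hψ.mono Set.inter_subset_right)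
    have hmem : Metric.ball w₀ ε ∩ B ∈ 𝓝[B] w₀ :=
      inter_mem (mem_nhdsWithin_of_mem_nhds (Metric.ball_mem_nhds _ hε)) self_mem_nhdsWithin
    obtain ⟨w₁, hw₁, hw₁'⟩ := ((mapClusterPt_iff_frequently.1 h₁ _
      (interior_mem_nhds.2 ht)).and_eventually hmem).exists
    obtain ⟨w₂, hw₂, hw₂'⟩ := ((mapClusterPt_iff_frequently.1 h₂ _
      (htc.isOpen_compl.mem_nhds hz₂t)).and_eventually hmem).exists
    obtain ⟨y, -, hy⟩ := hconn _ _ isOpen_interior htc.isOpen_compl (by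
        rintro _ ⟨w, hw, rfl⟩
        by_cases hwt : ψ w ∈ t
        · refine Or.inl (by_contra fun h => hball hw ?_)
          rw [htc.frontier_eq]
          exact ⟨hwt, h⟩
        · exact Or.inr hwt)
      ⟨ψ w₁, ⟨w₁, hw₁', rfl⟩, hw₁⟩ ⟨ψ w₂, ⟨w₂, hw₂', rfl⟩, hw₂⟩
    exact hy.2 (interior_subset hy.1)
  obtain ⟨y, hy, hyc⟩ :=
    (isClosed_frontier (s := t)).isCompact.exists_mapClusterPt_of_frequently hfreq
  rw [htc.frontier_eq] at hy
  rcases eq_or_ne y z₁ with rfl | hyz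
  · exact hy.2 (mem_interior_iff_mem_nhds.2 ht)
  · exact htE hy.1 ⟨hsub y hyc, hyz⟩

lemma HolAt.eventually_const_or_nhds_le_map {φ : OnePoint ℂ → ℂ} {z : OnePoint ℂ}
    (h : HolAt φ z) : (∀ᶠ y in 𝓝 z, φ y = φ z) ∨ 𝓝 (φ z) ≤ map φ (𝓝 z) := by
  have := AnalyticAt.eventually_constant_or_nhds_le_map_nhds h
  rw [chartInv_chart_self] at this
  refine this.imp (fun h => ?_) fun h => ?_
  · exact eventually_nhds_iff_chartInv.2 h
  · rwa [← map_chartInv_nhds_self z, map_map]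

section Koenigs

variable {f : OnePoint ℂ → OnePoint ℂ} {p : OnePoint ℂ} {φ : OnePoint ℂ → ℂ}

lemma IsKoenigsMap.holAt (h : IsKoenigsMap f p φ) : ∀ z ∈ basin f p, HolAt φ z := h.holomorphic

lemma IsKoenigsMap.chartDeriv_ne_zero (h : IsKoenigsMap f p φ) : chartDeriv φ p ≠ 0 :=
  h.deriv_ne_zero

lemma IsKoenigsMap.map_self (h : IsKoenigsMap f p φ) (hp : IsAttractingFixedPoint f p) :
    φ p = 0 := by
  have h1 := h.map_eq p (mem_basin_self hp.1)
  rw [hp.1] at h1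
  have h2 : multiplier f p ≠ 1 := by
    intro h
    have := hp.2
    rw [h, norm_one] at this
    exact lt_irrefl _ this
  have h3 : (multiplier f p - 1) * φ p = 0 := by linear_combination -h1
  exact (mul_eq_zero.1 h3).resolve_left (sub_ne_zero.2 h2)

/-- The derivative of the functional equation `φ ∘ f = λ φ`. -/
lemma IsKoenigsMap.chartDeriv_map_mul (h : IsKoenigsMap f p φ) (hf : ∀ z, HolMapAt f z)
    (hΩ : IsOpen (basin f p)) {z : OnePoint ℂ} (hz : z ∈ basin f p) :
    chartDeriv φ (f z) * localDeriv f z = multiplier f p * chartDeriv φ z := by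
  rw [← HolAt.chartDeriv_comp (h.holAt _ (map_mem_basin_iff.2 hz)) (hf z),
    ← HolAt.chartDeriv_const_mul _ (h.holAt z hz)]
  refine chartDeriv_congr ?_
  filter_upwards [hΩ.mem_nhds hz] with y hy
  exact h.map_eq y hy

/-- A section of a Koenigs map conjugates multiplication by the multiplier to `f`. -/
lemma IsKoenigsMap.map_section (h : IsKoenigsMap f p φ) (hf : ∀ z, HolMapAt f z)
    (hp : IsAttractingFixedPoint f p) {B : Set ℂ} {ψ : ℂ → OnePoint ℂ}
    (hψ : IsSection φ (basin f p) p B ψ) (hBo : IsOpen B) (hB : IsPreconnected B)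
    (h0 : (0 : ℂ) ∈ B) (hmul : ∀ w ∈ B, multiplier f p * w ∈ B) :
    ∀ w ∈ B, f (ψ w) = ψ (multiplier f p * w) := by
  have hcont : Continuous f := continuous_iff_continuousAt.2 fun z => (hf z).continuousAt
  have key : Set.EqOn (fun w => ψ (multiplier f p * w)) (fun w => f (ψ w)) B := by
    refine eqOn_of_comp_eq (φ := φ) hBo hB ?_ (hcont.comp_continuousOn hψ.continuousOn) ?_ ?_ h0 ?_
    · exact hψ.continuousOn.comp (continuous_const.mul continuous_id).continuousOn hmul
    · exact fun w hw => hψ.exists_injOn hBo h.holAt (hmul w hw)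
    · intro w hw
      rw [hψ.right_inv _ (hmul w hw), h.map_eq _ (hψ.mem w hw), hψ.right_inv w hw]
    · simp [hψ.zero, hp.1]
  exact fun w hw => (key hw).symm

section Disk

variable {r : ℝ} {ψ : ℂ → OnePoint ℂ}

/-- If a Koenigs map has a section `ψ` over a disk `D`, then `f` maps the closure of `ψ(D)` into
`ψ(D)`, because it maps `ψ(D)` into the compact set `ψ(λ D̄)`. -/
lemma IsKoenigsMap.map_mem_of_mem_closure (h : IsKoenigsMap f p φ) (hf : ∀ z, HolMapAt f z)
    (hp : IsAttractingFixedPoint f p) (hr : 0 < r)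
    (hψ : IsSection φ (basin f p) p (Metric.ball 0 r) ψ) {z : OnePoint ℂ}
    (hz : z ∈ closure (ψ '' Metric.ball 0 r)) : f z ∈ ψ '' Metric.ball 0 r := by
  set lam := multiplier f p
  have hcont : Continuous f := continuous_iff_continuousAt.2 fun z => (hf z).continuousAt
  have hlam : ‖lam‖ < 1 := hp.2
  have hsub : Metric.closedBall (0 : ℂ) (‖lam‖ * r) ⊆ Metric.ball 0 r :=
    Metric.closedBall_subset_ball (by nlinarith)
  have hmul : ∀ w ∈ Metric.ball (0 : ℂ) r, lam * w ∈ Metric.closedBall (0 : ℂ) (‖lam‖ * r) := by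
    intro w hw
    rw [mem_ball_zero_iff] at hw
    rw [mem_closedBall_zero_iff, norm_mul]
    gcongr
  have hK : IsClosed (ψ '' Metric.closedBall 0 (‖lam‖ * r)) :=
    ((isCompact_closedBall _ _).image_of_continuousOn (hψ.continuousOn.mono hsub)).isClosed
  have hV : ψ '' Metric.ball 0 r ⊆ f ⁻¹' (ψ '' Metric.closedBall 0 (‖lam‖ * r)) := by
    rintro _ ⟨w, hw, rfl⟩
    rw [Set.mem_preimage, h.map_section hf hp hψ Metric.isOpen_ball
      (convex_ball _ _).isPreconnected (Metric.mem_ball_self hr)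
      (fun w hw => hsub (hmul w hw)) w hw]
    exact ⟨_, hmul w hw, rfl⟩
  exact Set.image_mono hsub (closure_minimal hV (hK.preimage hcont) hz)

/-- Consider a section `ψ` of a Koenigs map over a disk of maximal radius, with image `V`. Then the
closure of `V` is mapped bijectively to the closed disk by `φ`, and its frontier contains a critical
point of `f`. -/
lemma IsKoenigsMap.exists_maximal_disk (h : IsKoenigsMap f p φ) (hf : ∀ z, HolMapAt f z)
    (hp : IsAttractingFixedPoint f p) (hΩ : IsOpen (basin f p))
    (hfib : ∀ y, {z | f z = y}.Finite) (hr : 0 < r)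
    (hψ : IsSection φ (basin f p) p (Metric.ball 0 r) ψ)
    (hmax : ∀ s > r, ¬ ∃ χ, IsSection φ (basin f p) p (Metric.ball 0 s) χ) :
    ∃ U : Set (OnePoint ℂ), IsCompact U ∧ U ∈ 𝓝 p ∧ U ⊆ immediateBasin f p ∧
      Set.BijOn φ U (Metric.closedBall 0 r) ∧ ∃ c ∈ frontier U, IsCriticalPoint f c := by
  have hcont : Continuous f := continuous_iff_continuousAt.2 fun z => (hf z).continuousAt
  set lam := multiplier f p
  set B := Metric.ball (0 : ℂ) r
  set V := ψ '' B
  have hBo : IsOpen B := Metric.isOpen_ball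
  have hBc : IsPreconnected B := (convex_ball _ _).isPreconnected
  have h0B : (0 : ℂ) ∈ B := Metric.mem_ball_self hr
  have hpV : p ∈ V := ⟨0, h0B, hψ.zero⟩
  have hVo : IsOpen V := hψ.isOpen_image hBo h.holAt
  have hmap : ∀ z ∈ closure V, f z ∈ V := fun z hz => h.map_mem_of_mem_closure hf hp hr hψ hz
  have hVΩ : V ⊆ basin f p := by
    rintro _ ⟨w, hw, rfl⟩
    exact hψ.mem w hw
  have hUΩ : closure V ⊆ basin f p := fun z hz => map_mem_basin_iff.1 (hVΩ (hmap z hz))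
  have hφc : ∀ z ∈ closure V, ContinuousAt φ z := fun z hz => (h.holAt z (hUΩ hz)).continuousAt
  have hφU : Set.MapsTo φ (closure V) (Metric.closedBall 0 r) := by
    intro z hz
    have h1 : φ '' V ⊆ B := by
      rintro _ ⟨_, ⟨w, hw, rfl⟩, rfl⟩
      rwa [hψ.right_inv w hw]
    exact Metric.closure_ball_subset_closedBall
      (closure_mono h1 (mem_closure_image (hφc z hz) hz))
  -- A point of the closure with value in the open disk lies on the section.
  have hsec : ∀ z ∈ closure V, φ z ∈ B → ψ (φ z) = z := by
    intro z hz hzB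
    have : (𝓝[V] z).NeBot := mem_closure_iff_nhdsWithin_neBot.1 hz
    have h1 : Tendsto (fun y => ψ (φ y)) (𝓝[V] z) (𝓝 (ψ (φ z))) :=
      ((hψ.continuousAt hBo hzB).comp (hφc z hz)).tendsto.mono_left nhdsWithin_le_nhds
    have h2 : Tendsto (fun y => ψ (φ y)) (𝓝[V] z) (𝓝 z) := by
      refine (tendsto_id.mono_left nhdsWithin_le_nhds).congr' ?_
      filter_upwards [self_mem_nhdsWithin] with y hy
      obtain ⟨w, hw, rfl⟩ := hy
      rw [hψ.right_inv w hw, id]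
    exact tendsto_nhds_unique h1 h2
  have hmul : ∀ w ∈ Metric.closedBall (0 : ℂ) r, lam * w ∈ B := by
    intro w hw
    rw [mem_closedBall_zero_iff] at hw
    rw [mem_ball_zero_iff, norm_mul]
    have : ‖lam‖ < 1 := hp.2
    nlinarith [norm_nonneg lam, norm_nonneg w]
  have hconj := h.map_section hf hp hψ hBo hBc h0B
    (fun w hw => hmul w (Metric.ball_subset_closedBall hw))
  have hcluster : ∀ z ∈ closure V, MapClusterPt z (𝓝[B] (φ z)) ψ := by
    intro z hz
    rw [mapClusterPt_iff_frequently]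
    intro s hs hev
    have h1 := (hφc z hz).eventually (eventually_nhdsWithin_iff.1 hev)
    obtain ⟨y, hy, hy1, hys⟩ :=
      ((mem_closure_iff_frequently.1 hz).and_eventually (h1.and hs)).exists
    obtain ⟨w, hw, rfl⟩ := hy
    rw [hψ.right_inv w hw] at hy1
    exact hy1 hw hys
  have hinj : Set.InjOn φ (closure V) := by
    intro z₁ hz₁ z₂ hz₂ he
    refine mapClusterPt_unique_of_finite (w₀ := φ z₁) (convex_ball 0 r) hψ.continuousOn
      (hfib (ψ (lam * φ z₁))) (fun y hy => ?_) (hcluster z₁ hz₁) (he ▸ hcluster z₂ hz₂)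
    have h1 : MapClusterPt (f y) (𝓝[B] (φ z₁)) (f ∘ ψ) := hy.continuousAt_comp hcont.continuousAt
    have h2 : Tendsto (f ∘ ψ) (𝓝[B] (φ z₁)) (𝓝 (ψ (lam * φ z₁))) := by
      have h3 : ContinuousAt (fun w => ψ (lam * w)) (φ z₁) :=
        ContinuousAt.comp (f := fun w => lam * w) (hψ.continuousAt hBo (hmul _ (hφU hz₁)))
          (continuous_const.mul continuous_id).continuousAt
      refine (h3.tendsto.mono_left nhdsWithin_le_nhds).congr' ?_
      filter_upwards [self_mem_nhdsWithin] with w hw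
      exact (hconj w hw).symm
    have h4 : (𝓝 (f y) ⊓ 𝓝 (ψ (lam * φ z₁))).NeBot := NeBot.mono h1 (inf_le_inf_left _ h2)
    exact eq_of_nhds_neBot h4
  have hsurj : Set.SurjOn φ (closure V) (Metric.closedBall 0 r) := by
    have h1 : IsClosed (φ '' closure V) := (isClosed_closure.isCompact.image_of_continuousOn
      fun z hz => (hφc z hz).continuousWithinAt).isClosed
    rw [Set.SurjOn, ← closure_ball (0 : ℂ) hr.ne']
    refine closure_minimal (fun w hw => ?_) h1
    exact ⟨ψ w, subset_closure ⟨w, hw, rfl⟩, hψ.right_inv w hw⟩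
  obtain ⟨c, hcU, hc⟩ : ∃ c ∈ closure V, chartDeriv φ c = 0 := by
    by_contra! hreg
    obtain ⟨s, hs, hex⟩ := exists_isSection_gt hr.le hΩ h.holAt isClosed_closure.isCompact hUΩ hinj
      hsurj hreg (subset_closure hpV) (h.map_self hp)
    exact hmax s hs hex
  have hreg : ∀ z ∈ V, chartDeriv φ z ≠ 0 := by
    rintro _ ⟨w, hw, rfl⟩
    exact hψ.chartDeriv_ne_zero hBo h.holAt hw
  have hcV : c ∉ V := fun hcV => hreg c hcV hc
  refine ⟨closure V, isClosed_closure.isCompact,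
    mem_of_superset (hVo.mem_nhds hpV) subset_closure, ?_, ⟨hφU, hinj, hsurj⟩, c, ?_, ?_⟩
  · exact (hBc.image _ hψ.continuousOn).closure.subset_connectedComponentIn
      (subset_closure hpV) hUΩ
  · rw [isClosed_closure.frontier_eq]
    refine ⟨hcU, fun hint => ?_⟩
    rcases (h.holAt c (hUΩ hcU)).eventually_const_or_nhds_le_map with hconst | hopen
    · obtain ⟨y, hyV, hy⟩ :=
        ((mem_closure_iff_frequently.1 hcU).and_eventually hconst.eventually_nhds).exists
      refine hreg y hyV ?_
      rw [chartDeriv_congr (χ := fun _ => φ c) hy]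
      exact deriv_const _ _
    · -- The open mapping theorem puts `φ c` in the open disk, so that `c` lies on the section.
      have h1 : φ '' closure V ∈ 𝓝 (φ c) :=
        hopen (image_mem_map (mem_interior_iff_mem_nhds.1 hint))
      have h2 : φ c ∈ interior (Metric.closedBall (0 : ℂ) r) :=
        mem_interior_iff_mem_nhds.2 (mem_of_superset h1 hφU.image_subset)
      rw [interior_closedBall _ hr.ne'] at h2
      exact hcV ⟨φ c, h2, hsec c hcU h2⟩
  · have h1 := h.chartDeriv_map_mul hf hΩ (hUΩ hcU)
    rw [hc, mul_zero] at h1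
    exact (mul_eq_zero.1 h1).resolve_left (hreg _ (hmap c hcU))

/-- A section of a Koenigs map inverts it on a compact set mapped bijectively to a closed disk. -/
lemma IsKoenigsMap.exists_section_of_bijOn (h : IsKoenigsMap f p φ)
    (hp : IsAttractingFixedPoint f p) {U : Set (OnePoint ℂ)} (hU : IsCompact U) (hpU : p ∈ U)
    (hUΩ : U ⊆ basin f p) (hbij : Set.BijOn φ U (Metric.closedBall 0 r)) :
    ∃ ψ, ContinuousOn ψ (Metric.closedBall 0 r) ∧ U = ψ '' Metric.closedBall 0 r ∧
      IsSection φ (basin f p) p (Metric.ball 0 r) ψ := by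
  have hinv : Set.InvOn (Function.invFunOn φ U) φ U (Metric.closedBall 0 r) := hbij.invOn_invFunOn
  have hbij' : Set.BijOn (Function.invFunOn φ U) (Metric.closedBall 0 r) U :=
    hinv.symm.bijOn hbij.surjOn.mapsTo_invFunOn hbij.mapsTo
  have hφc : ContinuousOn φ U := fun z hz =>
    (h.holAt z (hUΩ hz)).continuousAt.continuousWithinAt
  have hψc : ContinuousOn (Function.invFunOn φ U) (Metric.closedBall 0 r) := by
    rw [continuousOn_iff_isClosed]
    intro t ht
    refine ⟨φ '' (t ∩ U), ((hU.inter_left ht).image_of_continuousOn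
      (hφc.mono Set.inter_subset_right)).isClosed, ?_⟩
    ext w
    constructor
    · rintro ⟨hw, hwr⟩
      exact ⟨⟨_, ⟨hw, hbij'.mapsTo hwr⟩, hinv.2 hwr⟩, hwr⟩
    · rintro ⟨⟨z, ⟨hzt, hzU⟩, rfl⟩, hwr⟩
      refine ⟨?_, hwr⟩
      rw [Set.mem_preimage, hinv.1 hzU]
      exact hzt
  refine ⟨_, hψc, hbij'.image_eq.symm, hψc.mono Metric.ball_subset_closedBall, ?_, ?_, ?_⟩
  · exact fun w hw => hUΩ (hbij'.mapsTo (Metric.ball_subset_closedBall hw))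
  · exact fun w hw => hinv.2 (Metric.ball_subset_closedBall hw)
  · rw [← h.map_self hp, hinv.1 hpU]

end Disk

end Koenigs

/-! ### Sections over the whole plane -/

/-- The sphere minus a point is connected. -/
lemma isPreconnected_compl_singleton_sphere (L : OnePoint ℂ) :
    IsPreconnected ({L}ᶜ : Set (OnePoint ℂ)) := by
  induction L using OnePoint.rec with
  | infty =>
    rw [OnePoint.compl_infty]
    exact isPreconnected_range OnePoint.continuous_coe
  | coe a =>
    have h1 : IsPreconnected ({a}ᶜ : Set ℂ) :=
      (isConnected_compl_singleton_of_one_lt_rank (by simp) a).isPreconnected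
    refine (h1.image _ OnePoint.continuous_coe.continuousOn).subset_closure ?_ ?_
    · rintro _ ⟨w, hw, rfl⟩ h
      exact hw (OnePoint.coe_injective h)
    · intro z hz
      induction z using OnePoint.rec with
      | infty =>
        refine mem_closure_of_tendsto tendsto_coe_cobounded ?_
        filter_upwards [eventually_ne_cobounded a] with w hw
        exact ⟨w, hw, rfl⟩
      | coe z => exact subset_closure ⟨z, fun h => hz (congrArg _ h), rfl⟩

/-- The coordinate `z ↦ 1 / (z - z₀)` on the sphere minus `z₀`, with value `0` at `∞`. -/
noncomputable def poleChart (z₀ : ℂ) (z : OnePoint ℂ) : ℂ := z.elim 0 fun z => (z - z₀)⁻¹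

/-- The inverse of the coordinate `z ↦ 1 / (z - z₀)`. -/
noncomputable def poleChartInv (z₀ : ℂ) (v : ℂ) : OnePoint ℂ :=
  OnePoint.map (fun z => z + z₀) (chartInv ∞ v)

lemma continuous_poleChartInv (z₀ : ℂ) : Continuous (poleChartInv z₀) :=
  (OnePoint.continuous_map (Homeomorph.addRight z₀).continuous (by
    rw [Filter.coclosedCompact_eq_cocompact]
    exact (Homeomorph.addRight z₀).isClosedEmbedding.tendsto_cocompact)).comp
      continuous_chartInv_infty

lemma poleChartInv_poleChart {z₀ : ℂ} {z : OnePoint ℂ} (hz : z ≠ (z₀ : OnePoint ℂ)) :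
    poleChartInv z₀ (poleChart z₀ z) = z := by
  induction z using OnePoint.rec with
  | infty => simp [poleChart, poleChartInv]
  | coe z =>
    have h : z - z₀ ≠ 0 := fun h => hz (congrArg _ (sub_eq_zero.1 h))
    simp [poleChart, poleChartInv, chartInv_infty_of_ne (inv_ne_zero h)]

section Plane

variable {φ : OnePoint ℂ → ℂ} {Ω : Set (OnePoint ℂ)} {p : OnePoint ℂ} {ψ : ℂ → OnePoint ℂ}

/-- A section over the plane has a limit at infinity: in a coordinate with pole at a value of the
section, it is bounded near infinity by injectivity, so that the singularity is removable. -/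
lemma IsSection.exists_tendsto_cobounded (h : IsSection φ Ω p Set.univ ψ)
    (hφ : ∀ z ∈ Ω, HolAt φ z) : ∃ L, Tendsto ψ (Bornology.cobounded ℂ) (𝓝 L) := by
  have hinj : Function.Injective ψ := Set.injOn_univ.1 h.injOn
  obtain ⟨_, ⟨w₀, -, rfl⟩, ⟨z₀, hz₀⟩⟩ := (OnePoint.denseRange_coe (X := ℂ)).inter_open_nonempty
    _ (h.isOpen_image isOpen_univ hφ) ⟨ψ 0, 0, trivial, rfl⟩
  have hO : IsOpen (ψ '' Metric.ball w₀ 1) :=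
    (h.mono (Set.subset_univ _)).isOpen_image Metric.isOpen_ball hφ
  obtain ⟨ε, hε, hball⟩ := Metric.isOpen_iff.1 (hO.preimage OnePoint.continuous_coe) z₀
    ⟨w₀, Metric.mem_ball_self one_pos, hz₀.symm⟩
  have hfar : ∀ᶠ w in Bornology.cobounded ℂ, ψ w ≠ ∞ ∧ w ∉ Metric.ball w₀ 1 := by
    have h1 : {w | ψ w = ∞}.Subsingleton := fun v hv w hw => hinj (hv.trans hw.symm)
    exact Filter.Eventually.and (Bornology.isBounded_def.1 h1.finite.isBounded)
      (Bornology.isBounded_def.1 Metric.isBounded_ball)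
  have hgood : ∀ w, ψ w ≠ ∞ ∧ w ∉ Metric.ball w₀ 1 →
      DifferentiableAt ℂ (fun v => poleChart z₀ (ψ v)) w ∧ ‖poleChart z₀ (ψ w)‖ ≤ ε⁻¹ := by
    rintro w ⟨hw, hwb⟩
    obtain ⟨z, hz⟩ := OnePoint.ne_infty_iff_exists.1 hw
    have hzb : ε ≤ ‖z - z₀‖ := by
      by_contra! hlt
      obtain ⟨v, hv, hvz⟩ := hball (mem_ball_iff_norm.2 hlt)
      exact hwb (hinj (hvz.trans hz) ▸ hv)
    constructor
    · have h1 := h.differentiableAt_chart isOpen_univ hφ (Set.mem_univ w)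
      have h2 := h.eventually_continuousAt_chart isOpen_univ (Set.mem_univ w)
      simp only [← hz] at h1 h2
      have h3 : chart (z : OnePoint ℂ) (ψ w) - z₀ ≠ 0 := by
        rw [← hz, chart_coe_coe]
        intro h0
        rw [h0, norm_zero] at hzb
        linarith
      refine ((h1.sub_const z₀).inv h3).congr_of_eventuallyEq ?_
      filter_upwards [h2] with v hv
      rw [← hv.1]
      rfl
    · rw [← hz]
      simp only [poleChart, OnePoint.elim_some, norm_inv]
      gcongr
  have hev : ∀ᶠ u in 𝓝[≠] (0 : ℂ), u ≠ 0 ∧ ψ u⁻¹ ≠ ∞ ∧ u⁻¹ ∉ Metric.ball w₀ 1 :=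
    Filter.Eventually.and self_mem_nhdsWithin (tendsto_inv₀_nhdsNE_zero.eventually hfar)
  have hlim := Complex.tendsto_limUnder_of_differentiable_on_punctured_nhds_of_bounded_under
    (f := fun u => poleChart z₀ (ψ u⁻¹)) (c := 0)
    (by
      filter_upwards [hev] with u hu
      exact (hgood _ hu.2).1.comp u (differentiableAt_inv hu.1))
    ⟨ε⁻¹ + ‖poleChart z₀ (ψ (0 : ℂ)⁻¹)‖, by
      rw [eventually_map]
      filter_upwards [hev] with u hu
      exact (norm_sub_le _ _).trans (add_le_add_left (hgood _ hu.2).2 _)⟩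
  refine ⟨_, (((continuous_poleChartInv z₀).tendsto _).comp
    (hlim.comp (tendsto_nhdsWithin_iff.2 ⟨tendsto_inv₀_cobounded, ?_⟩))).congr' ?_⟩
  · filter_upwards [eventually_ne_cobounded 0] with w hw using inv_ne_zero hw
  · filter_upwards [hfar] with w hw
    simp only [Function.comp_apply, inv_inv]
    refine poleChartInv_poleChart fun he => hw.2 ?_
    rw [hinj (he.trans hz₀)]
    exact Metric.mem_ball_self one_pos

/-- The image of a section over the whole plane omits at most one point of the sphere. -/
lemma IsSection.exists_compl_singleton_subset_range (h : IsSection φ Ω p Set.univ ψ)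
    (hφ : ∀ z ∈ Ω, HolAt φ z) : ∃ L, ({L}ᶜ : Set (OnePoint ℂ)) ⊆ Set.range ψ := by
  obtain ⟨L, hL⟩ := h.exists_tendsto_cobounded hφ
  have hinj : Function.Injective ψ := Set.injOn_univ.1 h.injOn
  have hcont : Continuous ψ := continuousOn_univ.1 h.continuousOn
  have hopen : IsOpen (Set.range ψ) := by
    rw [← Set.image_univ]
    exact h.isOpen_image isOpen_univ hφ
  have hclosed : IsClosed (insert L (Set.range ψ)) := by
    have h1 : Continuous (fun z : OnePoint ℂ => z.elim L ψ) := by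
      rw [OnePoint.continuous_iff, Filter.coclosedCompact_eq_cocompact,
        ← Metric.cobounded_eq_cocompact]
      exact ⟨hL, hcont⟩
    have h2 : Set.range (fun z : OnePoint ℂ => z.elim L ψ) = insert L (Set.range ψ) := by
      ext y
      simp only [Set.mem_range, OnePoint.exists, OnePoint.elim_infty, OnePoint.elim_some,
        Set.mem_insert_iff, eq_comm]
    rw [← h2]
    exact (isCompact_range h1).isClosed
  refine ⟨L, (isPreconnected_compl_singleton_sphere L).subset_of_closure_inter_subset hopen ?_ ?_⟩
  · by_cases h0 : ψ 0 = L
    · exact ⟨ψ 1, fun h1 => zero_ne_one (hinj (h0.trans (Set.mem_singleton_iff.1 h1).symm)), 1, rfl⟩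
    · exact ⟨ψ 0, h0, 0, rfl⟩
  · rintro z ⟨hz, hzL⟩
    exact (closure_minimal (Set.subset_insert L _) hclosed hz).resolve_left hzL

end Plane

/-! ### Koenigs disks of rational maps -/

section RationalMaps

variable {R : RatFunc ℂ} {p : OnePoint ℂ} {φ : OnePoint ℂ → ℂ}

/-- A Koenigs map of a rational map of degree at least two has no section over the whole plane:
the rational map would be injective on its image, the sphere minus at most one point. -/
lemma IsKoenigsMap.not_isSection_univ (hR : 2 ≤ ratDegree R)
    (hp : IsAttractingFixedPoint (ratMap R) p) (h0 : multiplier (ratMap R) p ≠ 0)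
    (h : IsKoenigsMap (ratMap R) p φ) (ψ : ℂ → OnePoint ℂ) :
    ¬ IsSection φ (basin (ratMap R) p) p Set.univ ψ := by
  intro hψ
  obtain ⟨L, hL⟩ := hψ.exists_compl_singleton_subset_range h.holAt
  refine not_injOn_ratMap_compl_singleton hR L (Set.InjOn.mono hL ?_)
  have hconj := h.map_section (holMapAt_ratMap R) hp hψ isOpen_univ isPreconnected_univ
    (Set.mem_univ _) fun _ _ => Set.mem_univ _
  rintro _ ⟨v, rfl⟩ _ ⟨w, rfl⟩ hvw
  rw [hconj v trivial, hconj w trivial] at hvw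
  rw [mul_left_cancel₀ h0 (hψ.injOn trivial trivial hvw)]

lemma IsKoenigsMap.exists_disk (hR : 2 ≤ ratDegree R)
    (hp : IsAttractingFixedPoint (ratMap R) p) (h0 : multiplier (ratMap R) p ≠ 0)
    (h : IsKoenigsMap (ratMap R) p φ) :
    ∃ U : Set (OnePoint ℂ), IsCompact U ∧ U ∈ 𝓝 p ∧ U ⊆ immediateBasin (ratMap R) p ∧
      (∃ r : ℝ, 0 < r ∧ Set.BijOn φ U (Metric.closedBall 0 r)) ∧
      ∃ c ∈ frontier U, IsCriticalPoint (ratMap R) c := by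
  have hΩ := isOpen_basin (holMapAt_ratMap R) hp h0
  rcases exists_maximal_isSection hΩ h.holAt (mem_basin_self hp.1) (h.map_self hp)
    h.chartDeriv_ne_zero with ⟨ψ, hψ⟩ | ⟨r, hr, ⟨ψ, hψ⟩, hmax⟩
  · exact absurd hψ (h.not_isSection_univ hR hp h0 ψ)
  · obtain ⟨U, hU, hpU, hUi, hbij, hc⟩ := h.exists_maximal_disk (holMapAt_ratMap R) hp hΩ
      (finite_ratMap_fiber (one_le_two.trans hR)) hr hψ hmax
    exact ⟨U, hU, hpU, hUi, ⟨r, hr, hbij⟩, hc⟩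

/-- Two compact neighbourhoods mapped bijectively to disks by a Koenigs map are equal if the one
with the smaller disk contains a critical point `c` of `f`. Otherwise `c` would be on the section
given by the larger one over its open disk, where the derivative of the Koenigs map does not
vanish. -/
lemma IsKoenigsMap.disk_unique {f : OnePoint ℂ → OnePoint ℂ} (hf : ∀ z, HolMapAt f z)
    (hp : IsAttractingFixedPoint f p) (h0 : multiplier f p ≠ 0) (h : IsKoenigsMap f p φ)
    {U₁ U₂ : Set (OnePoint ℂ)} {r₁ r₂ : ℝ} (hr : r₁ ≤ r₂) (hr₁ : 0 < r₁)
    (hU₁ : IsCompact U₁) (hU₂ : IsCompact U₂) (hpU₁ : p ∈ U₁) (hpU₂ : p ∈ U₂)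
    (hUΩ₁ : U₁ ⊆ basin f p) (hUΩ₂ : U₂ ⊆ basin f p)
    (hb₁ : Set.BijOn φ U₁ (Metric.closedBall 0 r₁)) (hb₂ : Set.BijOn φ U₂ (Metric.closedBall 0 r₂))
    (hc : ∃ c ∈ U₁, IsCriticalPoint f c) : U₁ = U₂ := by
  obtain ⟨ψ₁, hψ₁c, hψ₁U, hψ₁⟩ := h.exists_section_of_bijOn hp hU₁ hpU₁ hUΩ₁ hb₁
  obtain ⟨ψ₂, hψ₂c, hψ₂U, hψ₂⟩ := h.exists_section_of_bijOn hp hU₂ hpU₂ hUΩ₂ hb₂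
  have heq : Set.EqOn ψ₁ ψ₂ (Metric.closedBall 0 r₁) :=
    (hψ₁.eqOn_ball h.holAt hψ₂ hr₁ hr).of_subset_closure hψ₁c
      (hψ₂c.mono (Metric.closedBall_subset_closedBall hr)) Metric.ball_subset_closedBall
      (closure_ball (0 : ℂ) hr₁.ne').ge
  rcases hr.eq_or_lt with rfl | hlt
  · rw [hψ₁U, hψ₂U, heq.image_eq]
  · exfalso
    obtain ⟨c, hcU, hc⟩ := hc
    rw [hψ₁U] at hcU
    obtain ⟨w, hw, rfl⟩ := hcU
    have h1 := h.chartDeriv_map_mul hf (isOpen_basin hf hp h0)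
      (hUΩ₁ (hψ₁U ▸ Set.mem_image_of_mem _ hw))
    rw [show localDeriv f (ψ₁ w) = 0 from hc, mul_zero, heq hw] at h1
    exact mul_ne_zero h0 (hψ₂.chartDeriv_ne_zero Metric.isOpen_ball h.holAt
      (Metric.closedBall_subset_ball hlt hw)) h1.symm

end RationalMaps

end RationalDynamics

theorem mainTheorem7 (R : RatFunc ℂ) (hR : 2 ≤ ratDegree R) (p : OnePoint ℂ)
    (hp : IsAttractingFixedPoint (ratMap R) p) :
    (∃ c ∈ immediateBasin (ratMap R) p, IsCriticalPoint (ratMap R) c) ∧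
    (multiplier (ratMap R) p ≠ 0 →
      (∃ φ : OnePoint ℂ → ℂ, IsKoenigsMap (ratMap R) p φ) ∧
      ∀ φ : OnePoint ℂ → ℂ, IsKoenigsMap (ratMap R) p φ →
        ∃! U : Set (OnePoint ℂ),
          IsCompact U ∧ U ∈ 𝓝 p ∧ U ⊆ immediateBasin (ratMap R) p ∧
          (∃ r : ℝ, 0 < r ∧ Set.BijOn φ U (Metric.closedBall 0 r)) ∧
          ∃ c ∈ frontier U, IsCriticalPoint (ratMap R) c) := by
  have hf := holMapAt_ratMap R
  refine ⟨?_, fun h0 => ⟨exists_isKoenigsMap hf hp h0, fun φ hφ => ?_⟩⟩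
  · by_cases h0 : multiplier (ratMap R) p = 0
    · exact ⟨p, mem_connectedComponentIn (mem_basin_self hp.1), h0⟩
    · obtain ⟨φ, hφ⟩ := exists_isKoenigsMap hf hp h0
      obtain ⟨U, hU, -, hUi, -, c, hc, hcrit⟩ := hφ.exists_disk hR hp h0
      exact ⟨c, hUi (hU.isClosed.frontier_subset hc), hcrit⟩
  · obtain ⟨U, hU, hpU, hUi, ⟨r, hr, hb⟩, c, hc, hcrit⟩ := hφ.exists_disk hR hp h0
    refine ⟨U, ⟨hU, hpU, hUi, ⟨r, hr, hb⟩, c, hc, hcrit⟩, ?_⟩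
    rintro U' ⟨hU', hpU', hUi', ⟨r', hr', hb'⟩, c', hc', hcrit'⟩
    have hsub : immediateBasin (ratMap R) p ⊆ basin (ratMap R) p := connectedComponentIn_subset _ _
    rcases le_total r r' with hle | hle
    · exact (hφ.disk_unique hf hp h0 hle hr hU hU' (mem_of_mem_nhds hpU) (mem_of_mem_nhds hpU')
        (hUi.trans hsub) (hUi'.trans hsub) hb hb'
        ⟨c, hU.isClosed.frontier_subset hc, hcrit⟩).symm
    · exact hφ.disk_unique hf hp h0 hle hr' hU' hU (mem_of_mem_nhds hpU') (mem_of_mem_nhds hpU)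
        (hUi'.trans hsub) (hUi.trans hsub) hb' hb
        ⟨c', hU'.isClosed.frontier_subset hc', hcrit'⟩
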